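/- Setting. Let $\Omega\subset\mathbb R^2$ be a bounded domain with polygonal boundary, $V:=H^1_0(\Omega,\mathbb C)$, and let $\mathcal T_h$ be a conforming decomposition of $\Omega$ into finitely many simple polygons $E$ (each edge not contained in $\partial\Omega$ is shared by exactly two elements) such that, with constants $\rho,C>0$ and $h_E=\operatorname{diam}E$, each $E$ is star-shaped with respect to a ball of radius $\ge\rho h_E$ and any two vertices of $E$ have distance $\ge Ch_E$. Let $\kappa:\Omega\to\mathbb R$ satisfy $\kappa\ge\kappa_0>0$ and be constant on each $E\in\mathcal T_h$, and let $\vartheta:\Omega\to\mathbb R^2$ be bounded, of class $C^1$ and divergence-free. For $U=\Omega$ or $U=E$ put $$a^U(w,v)=\int_U\kappa\nabla w\cdot\nabla\bar v,\qquad b^U(w,v)=\int_U(\vartheta\cdot\nabla w)\bar v,\qquad c^U(w,v)=\int_U w\bar v,$$ $a=a^\Omega$, $b=b^\Omega$, $c=c^\Omega$ and $\mathscr B=a+b$. Let $\widetilde V_h^E$ be the space of $v\in H^1(E,\mathbb C)$ with $\Delta v\in\mathbb P_1(E)$ whose trace on $\partial E$ is continuous and affine on each edge. For $v\in\widetilde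 V_h^E$ let $\Pi^{\nabla,E}v\in\mathbb P_1(E)$ be given by $\int_E\nabla(\Pi^{\nabla,E}v-v)\cdot\nabla q=0$ for all $q\in\mathbb P_1(E)$ and $\int_{\partial E}\Pi^{\nabla,E}v=\int_{\partial E}v$. Let $\Pi^E$ be the $L^2(E)$-projection onto $\mathbb P_1(E)$, let $V_h^E=\{v\in\widetilde V_h^E:\int_E(\Pi^{\nabla,E}v)\,p=\int_E v\,p\ \ \forall p\in\mathbb P_1(E)\}$, and $V_h=\{v\in V: v|_E\in V_h^E\ \forall E\in\mathcal T_h\}$. On $V_h^E$ let $S^E$ be a Hermitian positive semidefinite and $S_0^E$ a Hermitian positive definite sesquilinear form with $a_0a^E(w,w)\le S^E(w,w)\le a_1a^E(w,w)$ if $\Pi^{\nabla,E}w=0$ and $c_0c^E(w,w)\le S^E_0(w,w)\le c_1c^E(w,w)$ if $\Pi^Ew=0$, for constants $a_0,a_1,c_0,c_1>0$. Put $$\mathscr B_h(w,v)=\sum_E\big[a^E(\Pi^{\nabla,E}w,\Pi^{\nabla,E}v)+S^E(w-\Pi^{\nabla,E}w,v-\Pi^{\nabla,E}v)+b^E(\Pi^{\nabla,E}w,\Pi^Ev)\big],$$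 $$c_h(w,v)=\sum_E\big[c^E(\Pi^Ew,\Pi^Ev)+S_0^E(w-\Pi^Ew,v-\Pi^Ev)\big].$$ Let $\mathcal E_E$ be the set of edges of $E$ and $\boldsymbol n_E$ its outer unit normal. For functions $p_E\in\mathbb P_1(E)$, $E\in\mathcal T_h$, and an edge $\ell\not\subset\partial\Omega$ shared by $E$ and $E'$ put $[\![\kappa\,\partial p/\partial\boldsymbol n]\!]_\ell=\kappa|_E\nabla p_E\cdot\boldsymbol n_E+\kappa|_{E'}\nabla p_{E'}\cdot\boldsymbol n_{E'}$, and put $[\![\kappa\,\partial p/\partial\boldsymbol n]\!]_\ell=0$ if $\ell\subset\partial\Omega$. Integrals over edges involve the trace of $v$. Lemma (error equations). (i) Let $\lambda,\lambda_h\in\mathbb C$, $0\ne u\in V$, $0\ne u_h\in V_h$ with $\mathscr B(u,v)=\lambda c(u,v)$ for all $v\in V$ and $\mathscr B_h(u_h,v_h)=\lambda_hc_h(u_h,v_h)$ for all $v_h\in V_h$. Then for all $v\in V$ $$\begin{aligned}\mathscr B(u-u_h,v)={}&\lambda c(u,v)-\lambda_hc(u_h,v)\\&-\sum_{E}\big[a^E(u_h-\Pi^{\nabla,E}u_h,v)+b^E(u_h-\Pi^{\nabla,E}u_h,v)-\lambda_hc^E(u_h-\Pi^Eu_h,v)\big]\\&+\sum_E\int_E\big[\nabla\cdot(\kappa\nabla\Pi^{\nabla,E}u_h)-\vartheta\cdot\nabla\Pi^{\nabla,E}u_h+\lambda_h\Pi^Eu_h\big]\bar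 v\\&-\sum_E\sum_{\ell\in\mathcal E_E}\int_\ell\tfrac12\Big[\!\!\Big[\kappa\frac{\partial\Pi^{\nabla}u_h}{\partial\boldsymbol n}\Big]\!\!\Big]_\ell\bar v.\end{aligned}$$ (ii) Let $\lambda,\lambda_h\in\mathbb C$, $0\ne u^*\in V$, $0\ne u_h^*\in V_h$ be such that $\lambda^*=\bar\lambda$, $\lambda_h^*=\bar\lambda_h$ solve the dual problems $\mathscr B(v,u^*)=\overline{\lambda^*}c(v,u^*)$ for all $v\in V$ and $\mathscr B_h(v_h,u_h^*)=\overline{\lambda_h^*}c_h(v_h,u_h^*)$ for all $v_h\in V_h$. Then for all $v\in V$ $$\begin{aligned}\mathscr B(\bar v,u^*-u_h^*)={}&\lambda c(\overline{u^*},v)-\lambda_hc(\overline{u_h^*},v)\\&-\sum_{E}\big[a^E(\overline{u_h^*}-\overline{\Pi^{\nabla,E}u_h^*},v)-b^E(\overline{u_h^*}-\overline{\Pi^{\nabla,E}u_h^*},v)-\lambda_hc^E(\overline{u_h^*}-\overline{\Pi^Eu_h^*},v)\big]\\&+\sum_E\int_E\big[\nabla\cdot(\kappa\nabla\overline{\Pi^{\nabla,E}u_h^*})+\vartheta\cdot\nabla\overline{\Pi^{\nabla,E}u_h^*}+\lambda_h\overline{\Pi^Eu_h^*}\big]\bar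 v\\&-\sum_E\sum_{\ell\in\mathcal E_E}\int_\ell\tfrac12\Big[\!\!\Big[\kappa\frac{\partial\overline{\Pi^{\nabla}u_h^*}}{\partial\boldsymbol n}\Big]\!\!\Big]_\ell\bar v.\end{aligned}$$ -/

import Mathlib

open MeasureTheory Filter Topology Set
open scoped ContDiff ComplexConjugate

namespace VEM

noncomputable section

/-- The Euclidean plane. -/
abbrev Plane : Type := EuclideanSpace ℝ (Fin 2)

/-- Coordinate unit vector. -/
abbrev unitVec (i : Fin 2) : Plane := EuclideanSpace.single i 1

/-- Classical partial derivative of a complex-valued function on the plane. -/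
def pd (i : Fin 2) (f : Plane → ℂ) (x : Plane) : ℂ := fderiv ℝ f x (unitVec i)

/-- Pointwise complex conjugate of a function. -/
def cj (f : Plane → ℂ) : Plane → ℂ := fun x => conj (f x)

/-- Classical divergence of a complex vector field. -/
def divergence (F : Plane → Fin 2 → ℂ) (x : Plane) : ℂ := ∑ i, pd i (fun y => F y i) x

/-! ### Sobolev spaces -/

/-- `g` is the weak `i`-th partial derivative of `v` on `U`. -/
def HasWeakPartial (U : Set Plane) (v : Plane → ℂ) (i : Fin 2) (g : Plane → ℂ) : Prop :=
  ∀ φ : Plane → ℝ, ContDiff ℝ ∞ φ → HasCompactSupport φ → tsupport φ ⊆ U →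
    ∫ x in U, ((fderiv ℝ φ x (unitVec i) : ℝ) : ℂ) * v x = - ∫ x in U, (φ x : ℂ) * g x

/-- `v` (restricted to `U`) belongs to `H¹(U, ℂ)`. -/
def MemH1 (U : Set Plane) (v : Plane → ℂ) : Prop :=
  MemLp v 2 (volume.restrict U) ∧
    ∀ i, ∃ g : Plane → ℂ, MemLp g 2 (volume.restrict U) ∧ HasWeakPartial U v i g

open Classical in
/-- The weak partial derivative in `L²(U, ℂ)` (unique up to null sets; zero if there is none). -/
def weakPartial (U : Set Plane) (v : Plane → ℂ) (i : Fin 2) : Plane → ℂ :=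
  if h : ∃ g : Plane → ℂ, MemLp g 2 (volume.restrict U) ∧ HasWeakPartial U v i g
  then h.choose else 0

/-- The sequence `φ n` converges to `v` in the norm of `H¹(U, ℂ)`; here the `φ n` are smooth. -/
def TendstoH1 (U : Set Plane) (φ : ℕ → Plane → ℂ) (v : Plane → ℂ) : Prop :=
  Tendsto (fun n => eLpNorm (fun x => φ n x - v x) 2 (volume.restrict U)) atTop (𝓝 0) ∧
    ∀ i, Tendsto (fun n => eLpNorm (fun x => pd i (φ n) x - weakPartial U v i x) 2
      (volume.restrict U)) atTop (𝓝 0)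

/-- `H¹₀(U, ℂ)`: the closure of `C_c^∞(U, ℂ)` in `H¹(U, ℂ)`. -/
def H10 (U : Set Plane) : Set (Plane → ℂ) :=
  {v | MemH1 U v ∧ ∃ φ : ℕ → Plane → ℂ,
    (∀ n, ContDiff ℝ ∞ (φ n) ∧ HasCompactSupport (φ n) ∧ tsupport (φ n) ⊆ U) ∧
    TendstoH1 U φ v}

/-- Integral along the segment `γ '' [0,1]` with respect to arc length. -/
def edgeInt (γ : ℝ →ᵃ[ℝ] Plane) (f : Plane → ℂ) : ℂ :=
  (dist (γ 0) (γ 1) : ℂ) * ∫ s in (0 : ℝ)..1, f (γ s)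

/-- `g` is the trace of `v ∈ H¹(U, ℂ)` on the segment `γ '' [0,1]` of the boundary of `U`: the
limit in `L²` of the segment of the restrictions of functions, smooth up to the boundary,
which converge to `v` in `H¹(U, ℂ)`. -/
def IsTrace (U : Set Plane) (v : Plane → ℂ) (γ : ℝ →ᵃ[ℝ] Plane) (g : Plane → ℂ) : Prop :=
  MemH1 U v ∧ MemLp (fun s => g (γ s)) 2 (volume.restrict (Icc (0 : ℝ) 1)) ∧
    ∃ φ : ℕ → Plane → ℂ, (∀ n, ContDiff ℝ ∞ (φ n)) ∧ TendstoH1 U φ v ∧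
      Tendsto (fun n => eLpNorm (fun s => φ n (γ s) - g (γ s)) 2
        (volume.restrict (Icc (0 : ℝ) 1))) atTop (𝓝 0)

open Classical in
/-- The trace of `v ∈ H¹(U, ℂ)` on a segment of the boundary of `U`. -/
def trace (U : Set Plane) (v : Plane → ℂ) (γ : ℝ →ᵃ[ℝ] Plane) : Plane → ℂ :=
  if h : ∃ g, IsTrace U v γ g then h.choose else 0

/-! ### The sesquilinear forms -/

/-- `∫_U κ ∇w · ∇v̄`. -/
def aForm (κ : Plane → ℝ) (U : Set Plane) (w v : Plane → ℂ) : ℂ :=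
  ∫ x in U, (κ x : ℂ) * ∑ i, weakPartial U w i x * conj (weakPartial U v i x)

/-- `∫_U (ϑ · ∇w) v̄`. -/
def bForm (ϑ : Plane → Plane) (U : Set Plane) (w v : Plane → ℂ) : ℂ :=
  ∫ x in U, (∑ i, (ϑ x i : ℂ) * weakPartial U w i x) * conj (v x)

/-- `∫_U w v̄`. -/
def cForm (U : Set Plane) (w v : Plane → ℂ) : ℂ := ∫ x in U, w x * conj (v x)

/-- The sesquilinear form `B = a + b`. -/
def BForm (κ : Plane → ℝ) (ϑ : Plane → Plane) (U : Set Plane) (w v : Plane → ℂ) : ℂ :=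
  aForm κ U w v + bForm ϑ U w v

/-- `(lam, u)` solves the primal eigenvalue problem in `H¹₀(Ω, ℂ)`. -/
def IsEigenpair (Ω : Set Plane) (κ : Plane → ℝ) (ϑ : Plane → Plane)
    (lam : ℂ) (u : Plane → ℂ) : Prop :=
  u ∈ H10 Ω ∧ ¬ u =ᵐ[volume.restrict Ω] 0 ∧
    ∀ v ∈ H10 Ω, BForm κ ϑ Ω u v = lam * cForm Ω u v

/-- `(lam, u)` solves the dual eigenvalue problem in `H¹₀(Ω, ℂ)`. -/
def IsDualEigenpair (Ω : Set Plane) (κ : Plane → ℝ) (ϑ : Plane → Plane)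
    (lam : ℂ) (u : Plane → ℂ) : Prop :=
  u ∈ H10 Ω ∧ ¬ u =ᵐ[volume.restrict Ω] 0 ∧
    ∀ v ∈ H10 Ω, BForm κ ϑ Ω v u = conj lam * cForm Ω v u

/-! ### Polygons and meshes -/

/-- A bounded domain of the plane whose boundary is a finite union of segments. -/
structure IsPolygonalDomain (Ω : Set Plane) : Prop where
  isOpen : IsOpen Ω
  isConnected : IsConnected Ω
  isBounded : Bornology.IsBounded Ω
  boundary : ∃ s : Finset (Plane × Plane), (∀ p ∈ s, p.1 ≠ p.2) ∧
    frontier Ω = ⋃ p ∈ s, segment ℝ p.1 p.2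

/-- A simple polygon: the bounded region `carrier` (taken open) that is enclosed by the simple
closed polygonal line with vertices `poly 0, …, poly (n - 1)` (straight angles are allowed),
together with its outer unit normal `normal k` on the `k`-th edge. -/
structure Element where
  n : ℕ
  three_le : 3 ≤ n
  poly : Polygon Plane n
  injective : Function.Injective poly.vertices
  simple : ∀ k l, k ≠ l → poly.edgeSet ℝ k ∩ poly.edgeSet ℝ l ⊆
    {poly k, poly (finRotate n k)} ∩ {poly l, poly (finRotate n l)}
  carrier : Set Plane
  isOpen : IsOpen carrier
  isConnected : IsConnected carrier
  isBounded : Bornology.IsBounded carrier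
  frontier_eq : frontier carrier = poly.boundary ℝ
  normal : Fin n → Plane
  norm_normal : ∀ k, ‖normal k‖ = 1
  normal_orthogonal : ∀ k, inner ℝ (normal k) (poly (finRotate n k) - poly k) = 0
  normal_outer : ∀ k, ∀ x ∈ openSegment ℝ (poly k) (poly (finRotate n k)),
    ∀ᶠ t : ℝ in 𝓝[>] 0, x - t • normal k ∈ carrier ∧ x + t • normal k ∉ closure carrier

/-- A conforming decomposition of `Ω` into finitely many simple polygons. Every edge that does
not lie on the boundary of `Ω` is an edge of exactly one further element (hanging nodes count as
vertices). -/
structure Mesh (Ω : Set Plane) (ι : Type) where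
  elt : ι → Element
  subset : ∀ i, (elt i).carrier ⊆ Ω
  pairwise_disjoint : ∀ i j, i ≠ j → Disjoint (elt i).carrier (elt j).carrier
  cover : ⋃ i, closure (elt i).carrier = closure Ω
  conforming : ∀ i (k : Fin (elt i).n), ¬ (elt i).poly.edgeSet ℝ k ⊆ frontier Ω →
    ∃! p : (j : ι) × Fin (elt j).n,
      p.1 ≠ i ∧ (elt p.1).poly.edgeSet ℝ p.2 = (elt i).poly.edgeSet ℝ k

/-- Each element `E` is star-shaped with respect to a ball of radius at least `ρ h_E`. -/
def Mesh.StarShaped {Ω : Set Plane} {ι : Type} (M : Mesh Ω ι) (ρ : ℝ) : Prop :=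
  ∀ i, ∃ (z : Plane) (r : ℝ), ρ * Metric.diam (M.elt i).carrier ≤ r ∧
    ∀ y ∈ Metric.ball z r, StarConvex ℝ y (M.elt i).carrier

/-- Any two vertices of an element `E` have distance at least `C h_E`. -/
def Mesh.VerticesSeparated {Ω : Set Plane} {ι : Type} (M : Mesh Ω ι) (C : ℝ) : Prop :=
  ∀ i (k l : Fin (M.elt i).n), k ≠ l →
    C * Metric.diam (M.elt i).carrier ≤ dist ((M.elt i).poly k) ((M.elt i).poly l)

/-- `κ` is piecewise constant with respect to the mesh, with value `κE i` on the `i`-th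
element. -/
def Mesh.IsPiecewiseConst {Ω : Set Plane} {ι : Type} (M : Mesh Ω ι)
    (κ : Plane → ℝ) (κE : ι → ℝ) : Prop :=
  ∀ i, ∀ x ∈ (M.elt i).carrier, κ x = κE i

/-! ### Virtual element spaces and projections -/

/-- Complex polynomials of degree at most one on the plane. -/
def P1 : Set (Plane → ℂ) :=
  {p | ∃ (c : ℂ) (g : Fin 2 → ℂ), p = fun x => c + ∑ i, g i * (x i : ℂ)}

namespace Element

/-- Mean value over `∂E` of a function given edge by edge. -/
def bdryMean (E : Element) (g : Fin E.n → Plane → ℂ) : ℂ :=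
  (∑ k, edgeInt (E.poly.edgePath ℝ k) (g k)) /
    ((∑ k, dist (E.poly k) (E.poly (finRotate E.n k)) : ℝ) : ℂ)

/-- The larger local space: `v ∈ H¹(E, ℂ)` with (distributional) `Δv ∈ P₁(E)`, whose trace on
`∂E` is continuous and affine on each edge. -/
def VTilde (E : Element) : Set (Plane → ℂ) :=
  {v | MemH1 E.carrier v ∧
    (∃ p ∈ P1, ∀ φ : Plane → ℝ, ContDiff ℝ ∞ φ → HasCompactSupport φ →
      tsupport φ ⊆ E.carrier →
      ∫ x in E.carrier, ∑ i, weakPartial E.carrier v i x *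
        ((fderiv ℝ φ x (unitVec i) : ℝ) : ℂ) = - ∫ x in E.carrier, p x * (φ x : ℂ)) ∧
    ∃ g : Plane → ℂ, ContinuousOn g (frontier E.carrier) ∧
      ∀ k, IsTrace E.carrier v (E.poly.edgePath ℝ k) g ∧
        ∃ q ∈ P1, ∀ x ∈ E.poly.edgeSet ℝ k, g x = q x}

/-- `p` is the elliptic projection of `v` onto `P₁(E)`. -/
def IsPiNabla (E : Element) (v p : Plane → ℂ) : Prop :=
  p ∈ P1 ∧
  (∀ q ∈ P1, ∫ x in E.carrier, ∑ i, (pd i p x - weakPartial E.carrier v i x) * pd i q x = 0) ∧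
  E.bdryMean (fun _ => p) = E.bdryMean (fun k => trace E.carrier v (E.poly.edgePath ℝ k))

open Classical in
/-- The elliptic projection onto `P₁(E)`. -/
def piNabla (E : Element) (v : Plane → ℂ) : Plane → ℂ :=
  if h : ∃ p, E.IsPiNabla v p then h.choose else 0

/-- `p` is the `L²` projection of `v` onto `P₁(E)`. -/
def IsPiZero (E : Element) (v p : Plane → ℂ) : Prop :=
  p ∈ P1 ∧ ∀ q ∈ P1, ∫ x in E.carrier, p x * q x = ∫ x in E.carrier, v x * q x

open Classical in
/-- The `L²` projection onto `P₁(E)`. -/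
def piZero (E : Element) (v : Plane → ℂ) : Plane → ℂ :=
  if h : ∃ p, E.IsPiZero v p then h.choose else 0

/-- The local virtual element space. -/
def VLocal (E : Element) : Set (Plane → ℂ) :=
  {v | v ∈ E.VTilde ∧
    ∀ p ∈ P1, ∫ x in E.carrier, E.piNabla v x * p x = ∫ x in E.carrier, v x * p x}

/-- `S` is a Hermitian positive semidefinite sesquilinear form on the local virtual space. -/
structure IsHermitianForm (E : Element) (S : (Plane → ℂ) → (Plane → ℂ) → ℂ) : Prop where
  add_left : ∀ w₁ ∈ E.VLocal, ∀ w₂ ∈ E.VLocal, ∀ v ∈ E.VLocal, S (w₁ + w₂) v = S w₁ v + S w₂ v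
  smul_left : ∀ (c : ℂ), ∀ w ∈ E.VLocal, ∀ v ∈ E.VLocal, S (c • w) v = c * S w v
  symm : ∀ w ∈ E.VLocal, ∀ v ∈ E.VLocal, S v w = conj (S w v)
  nonneg : ∀ w ∈ E.VLocal, 0 ≤ (S w w).re

/-- Admissible stabilization of the diffusion form. -/
structure IsStabA (E : Element) (κ : Plane → ℝ) (a₀ a₁ : ℝ)
    (S : (Plane → ℂ) → (Plane → ℂ) → ℂ) : Prop where
  hermitian : E.IsHermitianForm S
  stable : ∀ w ∈ E.VLocal, E.piNabla w = 0 →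
    a₀ * (aForm κ E.carrier w w).re ≤ (S w w).re ∧
    (S w w).re ≤ a₁ * (aForm κ E.carrier w w).re

/-- Admissible stabilization of the mass form. -/
structure IsStabC (E : Element) (c₀ c₁ : ℝ)
    (S : (Plane → ℂ) → (Plane → ℂ) → ℂ) : Prop where
  hermitian : E.IsHermitianForm S
  pos : ∀ w ∈ E.VLocal, ¬ w =ᵐ[volume.restrict E.carrier] 0 → 0 < (S w w).re
  stable : ∀ w ∈ E.VLocal, E.piZero w = 0 →
    c₀ * (cForm E.carrier w w).re ≤ (S w w).re ∧
    (S w w).re ≤ c₁ * (cForm E.carrier w w).re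

/-- The discrete local form `a_h^E`. -/
def ah (E : Element) (κ : Plane → ℝ) (S : (Plane → ℂ) → (Plane → ℂ) → ℂ)
    (w v : Plane → ℂ) : ℂ :=
  aForm κ E.carrier (E.piNabla w) (E.piNabla v) + S (w - E.piNabla w) (v - E.piNabla v)

/-- The discrete local form `b_h^E`. -/
def bh (E : Element) (ϑ : Plane → Plane) (w v : Plane → ℂ) : ℂ :=
  bForm ϑ E.carrier (E.piNabla w) (E.piZero v)

/-- The discrete local form `c_h^E`. -/
def ch (E : Element) (S₀ : (Plane → ℂ) → (Plane → ℂ) → ℂ) (w v : Plane → ℂ) : ℂ :=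
  cForm E.carrier (E.piZero w) (E.piZero v) + S₀ (w - E.piZero w) (v - E.piZero v)

end Element

namespace Mesh

variable {Ω : Set Plane} {ι : Type}

/-- The global virtual element space, with zero boundary values. -/
def Vh (M : Mesh Ω ι) : Set (Plane → ℂ) := {v | v ∈ H10 Ω ∧ ∀ i, v ∈ (M.elt i).VLocal}

/-- The discrete form `B_h`. -/
def Bh [Fintype ι] (M : Mesh Ω ι) (κ : Plane → ℝ) (ϑ : Plane → Plane)
    (S : ι → (Plane → ℂ) → (Plane → ℂ) → ℂ) (w v : Plane → ℂ) : ℂ :=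
  ∑ i, ((M.elt i).ah κ (S i) w v + (M.elt i).bh ϑ w v)

/-- The discrete form `c_h`. -/
def ch [Fintype ι] (M : Mesh Ω ι) (S₀ : ι → (Plane → ℂ) → (Plane → ℂ) → ℂ)
    (w v : Plane → ℂ) : ℂ :=
  ∑ i, (M.elt i).ch (S₀ i) w v

/-- `(lamh, uh)` solves the discrete primal eigenvalue problem. -/
def IsDiscreteEigenpair [Fintype ι] (M : Mesh Ω ι) (κ : Plane → ℝ) (ϑ : Plane → Plane)
    (S S₀ : ι → (Plane → ℂ) → (Plane → ℂ) → ℂ) (lamh : ℂ) (uh : Plane → ℂ) : Prop :=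
  uh ∈ M.Vh ∧ ¬ uh =ᵐ[volume.restrict Ω] 0 ∧
    ∀ vh ∈ M.Vh, M.Bh κ ϑ S uh vh = lamh * M.ch S₀ uh vh

/-- `(lamh, uh)` solves the discrete dual eigenvalue problem. -/
def IsDiscreteDualEigenpair [Fintype ι] (M : Mesh Ω ι) (κ : Plane → ℝ) (ϑ : Plane → Plane)
    (S S₀ : ι → (Plane → ℂ) → (Plane → ℂ) → ℂ) (lamh : ℂ) (uh : Plane → ℂ) : Prop :=
  uh ∈ M.Vh ∧ ¬ uh =ᵐ[volume.restrict Ω] 0 ∧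
    ∀ vh ∈ M.Vh, M.Bh κ ϑ S vh uh = conj lamh * M.ch S₀ vh uh

/-- Outward normal flux `κ_E ∇p_E · n_E` on the `k`-th edge of the `i`-th element, for the
piecewise function `p`. -/
def flux (M : Mesh Ω ι) (κE : ι → ℝ) (p : ι → Plane → ℂ) (i : ι) (k : Fin (M.elt i).n)
    (x : Plane) : ℂ :=
  (κE i : ℂ) * ∑ m, pd m (p i) x * (((M.elt i).normal k m : ℝ) : ℂ)

open Classical in
/-- Jump of the normal flux over the `k`-th edge of the `i`-th element: the sum of the outward
fluxes from the two elements that share the edge; zero on edges that lie in `∂Ω`. -/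
def jump [Fintype ι] (M : Mesh Ω ι) (κE : ι → ℝ) (p : ι → Plane → ℂ) (i : ι)
    (k : Fin (M.elt i).n) (x : Plane) : ℂ :=
  if (M.elt i).poly.edgeSet ℝ k ⊆ frontier Ω then 0
  else M.flux κE p i k x + ∑ j, ∑ l,
    if j ≠ i ∧ (M.elt j).poly.edgeSet ℝ l = (M.elt i).poly.edgeSet ℝ k
    then M.flux κE p j l x else 0

end Mesh

end

end VEM

/-! Since `u` is an eigenfunction, B(u - u_h, v) = λ c(u, v) - B(u_h, v), so (i) reduces to an
identity for B(w, v), valid for every w in H¹(Ω) and all piecewise affine p, q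
(`Mesh.aForm_add_bForm_eq`). On each element E write w = (w - p) + p in a and b, and w = (w - q) + q
in the added mass term, then integrate a^E(p, v) by parts. As κ is constant on E and p is affine,
κ∇p is a constant vector: its divergence vanishes and only edge fluxes remain. Every interior edge
is met from exactly two elements, so the fluxes collect into jumps, each counted twice with weight
1/2; edges in ∂Ω contribute nothing because v ∈ H¹₀(Ω).

Against a constant vector, integration by parts only needs ∫_E ∂_m v = ∑ n_m ∫_ℓ v. For smooth
functions (`Element.IsStarBall.setIntegral_pd`), E is cut into the triangles spanned by the star
center and the edges; on a triangle the formula is Fubini and the fundamental theorem of calculus,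
and the inner sides cancel because all triangles have the same orientation. For v ∈ H¹₀(Ω) one
passes to the limit along C_c^∞(Ω). The rearrangement into jumps is done before the limit, where
both sides of an edge see the same function and this function vanishes on ∂Ω; traces from two
neighbours never have to be compared.

Convergence on the edges follows from a trace inequality (`Element.IsStarBall.exists_trace_le`),
obtained by integrating div((x - z)|φ|²) and using that (x - z)·n ≥ r/2 on every edge. It also shows
that the trace, defined through a choice, does not depend on the approximating sequence.

For (ii), conjugation gives a(v̄, w) = a(w̄, v) and c(v̄, w) = c(w̄, v), and div ϑ = 0 turns b(v̄,
w) on H¹₀ into the convection form of -ϑ at (w̄, v) (`bForm_cj_swap`). The same identity then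
applies with -ϑ, the conjugate of u_h* and the conjugated projections, which are again affine. -/

namespace VEM

noncomputable section

/-! ### The divergence theorem on a triangle -/

/-- The cross product of two plane vectors. -/
def cross (a b : Plane) : ℝ := a 0 * b 1 - a 1 * b 0

/-- The linear map sending the coordinate unit vectors to `a` and `b`. -/
def frameMap (a b : Plane) : Plane →L[ℝ] Plane :=
  (EuclideanSpace.proj (0 : Fin 2)).smulRight a + (EuclideanSpace.proj (1 : Fin 2)).smulRight b

@[simp]
lemma frameMap_apply (a b x : Plane) : frameMap a b x = x 0 • a + x 1 • b := rfl

lemma det_frameMap (a b : Plane) : (frameMap a b).det = cross a b := by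
  rw [ContinuousLinearMap.det, ← LinearMap.det_toMatrix (EuclideanSpace.basisFun (Fin 2) ℝ).toBasis,
    Matrix.det_fin_two]
  simp [LinearMap.toMatrix_apply, cross]
  ring

/-- The open reference triangle. -/
def refTri : Set Plane := {x | 0 < x 0 ∧ 0 < x 1 ∧ x 0 + x 1 < 1}

/-- The open triangle with vertices `z`, `a`, `b`. -/
def openTri (z a b : Plane) : Set Plane := (fun x => z + frameMap (a - z) (b - z) x) '' refTri

lemma isOpen_refTri : IsOpen refTri := by
  have h0 : Continuous fun x : Plane => x 0 := by fun_prop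
  have h1 : Continuous fun x : Plane => x 1 := by fun_prop
  exact (isOpen_lt continuous_const h0).inter ((isOpen_lt continuous_const h1).inter
    (isOpen_lt (h0.add h1) continuous_const))

lemma frameMap_injective {a b : Plane} (h : cross a b ≠ 0) : Function.Injective (frameMap a b) := by
  intro x y hxy
  have e0 := congrArg (fun v : Plane => v 0) hxy
  have e1 := congrArg (fun v : Plane => v 1) hxy
  simp only [frameMap_apply, PiLp.add_apply, PiLp.smul_apply, smul_eq_mul] at e0 e1
  have k0 : (x 0 - y 0) * cross a b = 0 := by unfold cross; linear_combination b 1 * e0 - b 0 * e1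
  have k1 : (x 1 - y 1) * cross a b = 0 := by unfold cross; linear_combination a 0 * e1 - a 1 * e0
  ext i
  fin_cases i
  · simpa [h, sub_eq_zero] using k0
  · simpa [h, sub_eq_zero] using k1

lemma setIntegral_openTri {z a b : Plane} (h : cross (a - z) (b - z) ≠ 0) (f : Plane → ℂ) :
    ∫ x in openTri z a b, f x =
      |cross (a - z) (b - z)| • ∫ x in refTri, f (z + frameMap (a - z) (b - z) x) := by
  rw [openTri, integral_image_eq_integral_abs_det_fderiv_smul volume isOpen_refTri.measurableSet
    (f' := fun _ => frameMap (a - z) (b - z))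
    (fun x _ => ((frameMap (a - z) (b - z)).hasFDerivAt.const_add z).hasFDerivWithinAt)
    (fun x _ y _ hxy => frameMap_injective h (add_left_cancel hxy)), det_frameMap, integral_smul]

/-- Coordinates identify the plane with `ℝ × ℝ`. -/
lemma measurePreserving_toPlane :
    MeasurePreserving (fun p : ℝ × ℝ => (!₂[p.1, p.2] : Plane)) := by
  have h := (PiLp.volume_preserving_toLp (Fin 2)).comp
    ((volume_preserving_finTwoArrow ℝ).symm)
  have e : (fun p : ℝ × ℝ => (!₂[p.1, p.2] : Plane)) =
      WithLp.toLp 2 ∘ (MeasurableEquiv.finTwoArrow (α := ℝ)).symm := by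
    funext p
    ext i
    fin_cases i <;> rfl
  rw [e]
  exact h

lemma measurableEmbedding_toPlane :
    MeasurableEmbedding (fun p : ℝ × ℝ => (!₂[p.1, p.2] : Plane)) := by
  have h := ((MeasurableEquiv.finTwoArrow (α := ℝ)).symm.trans
    (MeasurableEquiv.toLp 2 (Fin 2 → ℝ))).measurableEmbedding
  have e : (fun p : ℝ × ℝ => (!₂[p.1, p.2] : Plane)) =
      (MeasurableEquiv.finTwoArrow (α := ℝ)).symm.trans (MeasurableEquiv.toLp 2 (Fin 2 → ℝ)) := by
    funext p
    ext i
    fin_cases i <;> rfl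
  rw [e]
  exact h

lemma setIntegral_prodTri {g : ℝ × ℝ → ℂ} (hg : Continuous g) :
    ∫ p in {p : ℝ × ℝ | 0 < p.1 ∧ 0 < p.2 ∧ p.1 + p.2 < 1}, g p =
      ∫ x in (0 : ℝ)..1, ∫ y in (0 : ℝ)..(1 - x), g (x, y) := by
  have hT : IsOpen {p : ℝ × ℝ | 0 < p.1 ∧ 0 < p.2 ∧ p.1 + p.2 < 1} :=
    (isOpen_lt continuous_const continuous_fst).inter
      ((isOpen_lt continuous_const continuous_snd).inter
        (isOpen_lt (continuous_fst.add continuous_snd) continuous_const))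
  have hi : IntegrableOn g {p : ℝ × ℝ | 0 < p.1 ∧ 0 < p.2 ∧ p.1 + p.2 < 1} := by
    refine (hg.continuousOn.integrableOn_compact
      ((isCompact_Icc (a := (0 : ℝ)) (b := 1)).prod (isCompact_Icc (a := (0 : ℝ)) (b := 1)))).mono_set ?_
    rintro ⟨x, y⟩ ⟨h1, h2, h3⟩
    simp only [mem_prod, mem_Icc] at *
    refine ⟨⟨?_, ?_⟩, ?_, ?_⟩ <;> linarith
  rw [← integral_indicator hT.measurableSet, Measure.volume_eq_prod,
    integral_prod _ (by rw [← Measure.volume_eq_prod]; exact hi.integrable_indicator hT.measurableSet),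
    intervalIntegral.integral_of_le zero_le_one, ← integral_indicator measurableSet_Ioc]
  congr 1
  funext x
  by_cases hx : x ∈ Ioc (0 : ℝ) 1
  · rw [indicator_of_mem hx, intervalIntegral.integral_of_le (by linarith [hx.2]),
      integral_Ioc_eq_integral_Ioo, ← integral_indicator measurableSet_Ioo]
    congr 1
    funext y
    have : (x, y) ∈ {p : ℝ × ℝ | 0 < p.1 ∧ 0 < p.2 ∧ p.1 + p.2 < 1} ↔ y ∈ Ioo 0 (1 - x) := by
      simp only [mem_ofPred_eq, mem_Ioo]
      exact ⟨fun h => ⟨h.2.1, by linarith [h.2.2]⟩, fun h => ⟨hx.1, h.1, by linarith [h.2]⟩⟩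
    by_cases hy : y ∈ Ioo 0 (1 - x)
    · rw [indicator_of_mem hy, indicator_of_mem (this.2 hy)]
    · rw [indicator_of_notMem hy, indicator_of_notMem (fun h => hy (this.1 h))]
  · rw [indicator_of_notMem hx]
    refine integral_eq_zero_of_ae (Eventually.of_forall fun y => ?_)
    refine indicator_of_notMem (fun h => hx ?_) _
    exact ⟨h.1, by linarith [h.2.1, h.2.2]⟩

lemma setIntegral_refTri {f : Plane → ℂ} (hf : Continuous f) :
    ∫ x in refTri, f x = ∫ x in (0 : ℝ)..1, ∫ y in (0 : ℝ)..(1 - x), f !₂[x, y] := by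
  rw [← measurePreserving_toPlane.setIntegral_preimage_emb measurableEmbedding_toPlane]
  exact setIntegral_prodTri (g := fun p => f !₂[p.1, p.2]) (by fun_prop)

/-- Both orders of integration are needed: a derivative along either side of the triangle at `z`
must be integrated first in its own variable. -/
lemma setIntegral_refTri_swap {f : Plane → ℂ} (hf : Continuous f) :
    ∫ x in refTri, f x = ∫ y in (0 : ℝ)..1, ∫ x in (0 : ℝ)..(1 - y), f !₂[x, y] := by
  rw [← measurePreserving_toPlane.setIntegral_preimage_emb measurableEmbedding_toPlane,
    Measure.volume_eq_prod, ← (Measure.measurePreserving_swap (μ := (volume : Measure ℝ))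
      (ν := (volume : Measure ℝ))).setIntegral_preimage_emb
      MeasurableEquiv.prodComm.measurableEmbedding]
  rw [← setIntegral_prodTri (g := fun p => f !₂[p.2, p.1]) (by fun_prop)]
  congr 2
  ext ⟨x, y⟩
  simp only [refTri, mem_preimage, mem_ofPred_eq, Prod.swap_prod_mk]
  simp
  constructor <;> rintro ⟨h1, h2, h3⟩ <;> exact ⟨h2, h1, by linarith⟩

/-- Integral of `φ` over the segment from `p` to `q`, with respect to the unit parameter. -/
def segInt (φ : Plane → ℂ) (p q : Plane) : ℂ := ∫ s in (0 : ℝ)..1, φ (AffineMap.lineMap p q s)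

lemma segInt_symm (φ : Plane → ℂ) (p q : Plane) : segInt φ q p = segInt φ p q := by
  unfold segInt
  have := intervalIntegral.integral_comp_sub_left
    (fun s : ℝ => φ (AffineMap.lineMap q p s)) (a := 0) (b := 1) 1
  simp only [sub_self, sub_zero] at this
  rw [← this]
  simp only [AffineMap.lineMap_apply_one_sub]

lemma hasDerivAt_line {φ : Plane → ℂ} (hφ : ContDiff ℝ 1 φ) (p v : Plane) (t : ℝ) :
    HasDerivAt (fun t : ℝ => φ (p + t • v)) (fderiv ℝ φ (p + t • v) v) t := by
  have h1 : HasDerivAt (fun t : ℝ => p + t • v) v t := by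
    simpa using ((hasDerivAt_id t).smul_const v).const_add p
  exact ((hφ.differentiable one_ne_zero _).hasFDerivAt.comp_hasDerivAt t h1)

lemma integral_fderiv_line {φ : Plane → ℂ} (hφ : ContDiff ℝ 1 φ) (p v : Plane) (c : ℝ) :
    ∫ t in (0 : ℝ)..c, fderiv ℝ φ (p + t • v) v = φ (p + c • v) - φ p := by
  rw [intervalIntegral.integral_eq_sub_of_hasDerivAt (fun t _ => hasDerivAt_line hφ p v t)]
  · simp
  · have h := hφ.continuous_fderiv one_ne_zero
    have : Continuous fun t : ℝ => fderiv ℝ φ (p + t • v) v := by fun_prop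
    exact this.intervalIntegrable _ _

lemma continuous_comp_lineMap {φ : Plane → ℂ} (hφ : Continuous φ) (p q : Plane) :
    Continuous fun s : ℝ => φ (AffineMap.lineMap p q s) :=
  hφ.comp AffineMap.lineMap_continuous

/-- The inner integral runs in the direction `a - z` and is exact. Its upper end `x = 1 - y` sweeps
the side from `a` to `b`, its lower end `x = 0` the side from `z` to `b`. -/
lemma setIntegral_refTri_left {φ : Plane → ℂ} (hφ : ContDiff ℝ 1 φ) (z a b : Plane) :
    ∫ x in refTri, fderiv ℝ φ (z + frameMap (a - z) (b - z) x) (a - z) =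
      segInt φ a b - segInt φ z b := by
  have hc := hφ.continuous_fderiv one_ne_zero
  rw [setIntegral_refTri_swap (by fun_prop), segInt, segInt,
    ← intervalIntegral.integral_sub
      ((continuous_comp_lineMap hφ.continuous a b).intervalIntegrable _ _)
      ((continuous_comp_lineMap hφ.continuous z b).intervalIntegrable _ _)]
  congr 1
  funext y
  have h := integral_fderiv_line hφ (z + y • (b - z)) (a - z) (1 - y)
  have e : ∀ x : ℝ, z + frameMap (a - z) (b - z) !₂[x, y] = z + y • (b - z) + x • (a - z) := by
    intro x
    simp [frameMap_apply]
    abel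
  simp only [e]
  rw [h]
  congr 2
  · rw [AffineMap.lineMap_apply_module]; module
  · rw [AffineMap.lineMap_apply_module]; module

lemma setIntegral_refTri_right {φ : Plane → ℂ} (hφ : ContDiff ℝ 1 φ) (z a b : Plane) :
    ∫ x in refTri, fderiv ℝ φ (z + frameMap (a - z) (b - z) x) (b - z) =
      segInt φ a b - segInt φ z a := by
  have hc := hφ.continuous_fderiv one_ne_zero
  rw [setIntegral_refTri (by fun_prop), ← segInt_symm, segInt, segInt,
    ← intervalIntegral.integral_sub
      ((continuous_comp_lineMap hφ.continuous b a).intervalIntegrable _ _)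
      ((continuous_comp_lineMap hφ.continuous z a).intervalIntegrable _ _)]
  congr 1
  funext y
  have h := integral_fderiv_line hφ (z + y • (a - z)) (b - z) (1 - y)
  have e : ∀ x : ℝ, z + frameMap (a - z) (b - z) !₂[y, x] = z + y • (a - z) + x • (b - z) := by
    intro x
    simp [frameMap_apply]
    abel
  simp only [e]
  rw [h]
  congr 2
  · rw [AffineMap.lineMap_apply_module]; module
  · rw [AffineMap.lineMap_apply_module]; module

/-- The vector `v`, rotated clockwise by a right angle. -/
def rot (v : Plane) : Plane := !₂[v 1, - v 0]

/-- The signed flux `∫ φ n_m` through the segment from `p` to `q`. -/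
def segFlux (φ : Plane → ℂ) (m : Fin 2) (p q : Plane) : ℂ := (rot (q - p) m : ℂ) * segInt φ p q

lemma integrableOn_refTri {f : Plane → ℂ} (hf : Continuous f) : IntegrableOn f refTri := by
  have hK : IsCompact (Metric.closedBall (0 : Plane) 2) := isCompact_closedBall _ _
  refine (hf.continuousOn.integrableOn_compact hK).mono_set ?_
  rintro x ⟨h0, h1, h2⟩
  rw [mem_closedBall_zero_iff, EuclideanSpace.norm_eq]
  refine Real.sqrt_le_iff.2 ⟨by norm_num, ?_⟩
  simp only [Fin.sum_univ_two, Real.norm_eq_abs, sq_abs]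
  nlinarith

/-- The divergence theorem on a triangle, for one component. -/
lemma cross_mul_setIntegral_refTri {φ : Plane → ℂ} (hφ : ContDiff ℝ 1 φ) (m : Fin 2)
    (z a b : Plane) :
    (cross (a - z) (b - z) : ℂ) * ∫ x in refTri, pd m φ (z + frameMap (a - z) (b - z) x) =
      segFlux φ m z a + segFlux φ m a b - segFlux φ m z b := by
  have hc := hφ.continuous_fderiv one_ne_zero
  have hl := setIntegral_refTri_left hφ z a b
  have hr := setIntegral_refTri_right hφ z a b
  -- Cramer's rule: a coordinate derivative in terms of the derivatives along the two sides at `z`.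
  -- The coefficients are components of the rotated sides, that is, unnormalized normals.
  have key : ∀ y, (cross (a - z) (b - z) : ℂ) * pd m φ y =
      (rot (b - z) m : ℂ) * fderiv ℝ φ y (a - z) - (rot (a - z) m : ℂ) * fderiv ℝ φ y (b - z) := by
    intro y
    have ev : ∀ v : Plane, fderiv ℝ φ y v = (v 0 : ℂ) * pd 0 φ y + (v 1 : ℂ) * pd 1 φ y := by
      intro v
      have : v = v 0 • unitVec 0 + v 1 • unitVec 1 := by
        ext i; fin_cases i <;> simp [unitVec]
      conv_lhs => rw [this]
      simp [pd]
    rw [ev, ev]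
    fin_cases m <;> simp [rot, cross] <;> ring
  rw [← integral_const_mul]
  simp only [key]
  rw [integral_sub, integral_const_mul, integral_const_mul, hl, hr]
  · simp only [segFlux]
    -- The side from `a` to `b` receives both coefficients, which add up to its own rotated vector.
    have : ((rot (b - a) m : ℝ) : ℂ) = rot (b - z) m - rot (a - z) m := by
      fin_cases m <;> simp [rot]
    rw [this]
    ring
  · exact (integrableOn_refTri (by fun_prop))
  · exact (integrableOn_refTri (by fun_prop))

/-! ### Geometry of star-shaped polygons -/

/-- `E` is star-shaped with respect to every point of the ball of radius `r` around `z`. -/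
structure Element.IsStarBall (E : Element) (z : Plane) (r : ℝ) : Prop where
  pos : 0 < r
  star : ∀ y ∈ Metric.ball z r, StarConvex ℝ y E.carrier

/-- Polar description: `s` selects the point of the open side opposite to `z`, and `t` the position
on the ray from `z` to it. The frame coordinates are `t * (1 - s)` and `t * s`. -/
lemma mem_openTri_iff {z a b w : Plane} : w ∈ openTri z a b ↔
    ∃ s ∈ Ioo (0 : ℝ) 1, ∃ t ∈ Ioo (0 : ℝ) 1,
      w = AffineMap.lineMap z (AffineMap.lineMap a b s : Plane) t := by
  constructor
  · rintro ⟨x, ⟨h0, h1, h2⟩, rfl⟩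
    have hp : 0 < x 0 + x 1 := by linarith
    refine ⟨x 1 / (x 0 + x 1), ⟨by positivity, (div_lt_one hp).2 (by linarith)⟩, x 0 + x 1,
      ⟨hp, h2⟩, ?_⟩
    simp only [frameMap_apply, AffineMap.lineMap_apply_module']
    have : (x 0 + x 1) * (x 1 / (x 0 + x 1)) = x 1 := by field_simp
    rw [add_comm z, add_sub_assoc, smul_add, smul_smul, this]
    module
  · rintro ⟨s, ⟨s0, s1⟩, t, ⟨t0, t1⟩, rfl⟩
    refine ⟨!₂[t * (1 - s), t * s], ⟨?_, ?_, ?_⟩, ?_⟩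
    · exact mul_pos t0 (by linarith)
    · exact mul_pos t0 s0
    · simp; linarith
    · simp [AffineMap.lineMap_apply_module']
      module

lemma volume_line_eq_zero (a b : Plane) : volume (line[ℝ, a, b] : Set Plane) = 0 := by
  refine Measure.addHaar_affineSubspace _ _ fun h => ?_
  have h2 := (collinear_pair ℝ a b).finrank_le_one
  rw [← direction_affineSpan, h, AffineSubspace.direction_top, finrank_top,
    finrank_euclideanSpace, Fintype.card_fin] at h2
  omega

lemma finRotate_ne {n : ℕ} (hn : 2 ≤ n) (k : Fin n) : finRotate n k ≠ k := by
  obtain ⟨m, rfl⟩ : ∃ m, n = m + 2 := ⟨n - 2, by omega⟩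
  rw [finRotate_apply]
  simp

lemma inner_plane (a b : Plane) : inner ℝ a b = a 0 * b 0 + a 1 * b 1 := by
  simp [PiLp.inner_apply, Fin.sum_univ_two, mul_comm]

lemma norm_sq_plane (a : Plane) : ‖a‖ ^ 2 = a 0 ^ 2 + a 1 ^ 2 := by
  rw [EuclideanSpace.norm_sq_eq]; simp [Fin.sum_univ_two]

/-- A vector orthogonal to a unit vector `n` is a multiple of the rotated vector. -/
lemma eq_smul_rot_of_inner_eq_zero {n e : Plane} (hn : ‖n‖ = 1) (he : inner ℝ n e = 0) :
    e = cross e n • rot n := by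
  rw [inner_plane] at he
  have h1 : n 0 ^ 2 + n 1 ^ 2 = 1 := by rw [← norm_sq_plane, hn]; norm_num
  ext i
  fin_cases i <;> simp [rot, cross]
  · linear_combination n 0 * he - e 0 * h1
  · linear_combination n 1 * he - e 1 * h1

namespace Element

variable {E : Element} {z : Plane} {r : ℝ}

lemma vertex_ne (E : Element) (k : Fin E.n) : E.poly k ≠ E.poly (finRotate E.n k) :=
  fun h => finRotate_ne (by have := E.three_le; omega) k (E.injective h).symm

lemma lineMap_mem_edgeSet (E : Element) (k : Fin E.n) {s : ℝ} (hs : s ∈ Icc (0 : ℝ) 1) :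
    (AffineMap.lineMap (E.poly k) (E.poly (finRotate E.n k)) s : Plane) ∈ E.poly.edgeSet ℝ k :=
  ⟨s, hs, rfl⟩

lemma edgeSet_subset_frontier (E : Element) (k : Fin E.n) :
    E.poly.edgeSet ℝ k ⊆ frontier E.carrier := by
  rw [E.frontier_eq]
  exact subset_iUnion (fun i => E.poly.edgeSet ℝ i) k

lemma disjoint_frontier (E : Element) {x : Plane} (hx : x ∈ E.carrier)
    (hf : x ∈ frontier E.carrier) : False := by
  have : x ∈ E.carrier ∩ frontier E.carrier := ⟨hx, hf⟩
  rw [E.isOpen.inter_frontier_eq] at this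
  exact this

/-- The point `x` is only in the closure, so it is replaced by a nearby `w` in the polygon. Moving
the center from `y` to `y + (t / (1 - t)) • (x - w)` keeps the point of the segment fixed, and for
`w` close to `x` the new center is still in the ball. -/
lemma IsStarBall.lineMap_mem (h : E.IsStarBall z r) {x y : Plane} (hx : x ∈ closure E.carrier)
    (hy : y ∈ Metric.ball z r) {t : ℝ} (ht : t ∈ Ico (0 : ℝ) 1) :
    (AffineMap.lineMap y x t : Plane) ∈ E.carrier := by
  have ht1 : 0 < 1 - t := by linarith [ht.2]
  have hc : Continuous fun w : Plane => y + (t / (1 - t)) • (x - w) := by fun_prop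
  have hU : IsOpen ((fun w : Plane => y + (t / (1 - t)) • (x - w)) ⁻¹' Metric.ball z r) :=
    Metric.isOpen_ball.preimage hc
  obtain ⟨w, hw, hwE⟩ := mem_closure_iff.1 hx _ hU (by simpa using hy)
  have hm := h.star _ hw hwE ht1.le ht.1 (by ring)
  convert hm using 1
  rw [AffineMap.lineMap_apply_module, smul_add, smul_smul, mul_div_cancel₀ _ ht1.ne']
  module

lemma IsStarBall.center_mem (h : E.IsStarBall z r) : z ∈ Metric.ball z r :=
  Metric.mem_ball_self h.pos

/-- A ray from the center meets the boundary only once. -/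
lemma IsStarBall.eq_of_mem_ray (h : E.IsStarBall z r) {x y : Plane}
    (hx : x ∈ frontier E.carrier) (hy : y ∈ frontier E.carrier) {c : ℝ} (hc : 0 < c)
    (hxy : x - z = c • (y - z)) : x = y := by
  rcases lt_trichotomy c 1 with h1 | h1 | h1
  · refine (E.disjoint_frontier ?_ hx).elim
    have := h.lineMap_mem (frontier_subset_closure hy) h.center_mem ⟨hc.le, h1⟩
    rwa [AffineMap.lineMap_apply_module', ← hxy, sub_add_cancel] at this
  · simpa [h1] using hxy
  · refine (E.disjoint_frontier ?_ hy).elim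
    have := h.lineMap_mem (frontier_subset_closure hx) h.center_mem (t := c⁻¹)
      ⟨by positivity, inv_lt_one_of_one_lt₀ h1⟩
    rwa [AffineMap.lineMap_apply_module', hxy, smul_smul, inv_mul_cancel₀ hc.ne', one_smul,
      sub_add_cancel] at this

/-- A ray from the center through a point of the polygon meets the boundary. -/
lemma exists_frontier_of_mem (E : Element) {w : Plane} (hw : w ∈ E.carrier) (hwz : w ≠ z) :
    ∃ x ∈ frontier E.carrier, ∃ t ∈ Ioo (0 : ℝ) 1, w = AffineMap.lineMap z x t := by
  set f : ℝ → Plane := fun τ => z + τ • (w - z) with hf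
  have hfc : Continuous f := by fun_prop
  have hd : 0 < ‖w - z‖ := norm_pos_iff.2 (sub_ne_zero.2 hwz)
  obtain ⟨R, hR⟩ := E.isBounded.subset_closedBall z
  obtain ⟨T, hT1, hT⟩ : ∃ T : ℝ, 1 ≤ T ∧ f T ∉ E.carrier := by
    refine ⟨max 1 ((|R| + 1) / ‖w - z‖), le_max_left _ _, fun hm => ?_⟩
    have := hR hm
    rw [mem_closedBall_iff_norm, hf, add_sub_cancel_left, norm_smul, Real.norm_eq_abs] at this
    have h2 : (|R| + 1) / ‖w - z‖ * ‖w - z‖ = |R| + 1 := by field_simp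
    have h3 : (|R| + 1) / ‖w - z‖ ≤ |max 1 ((|R| + 1) / ‖w - z‖)| :=
      (le_max_right _ _).trans (le_abs_self _)
    nlinarith [le_abs_self R]
  -- The least parameter beyond `1` at which the ray is outside the polygon. Just before it the ray
  -- is inside, so the exit point lies in the closure.
  have hK : IsCompact (Icc 1 T ∩ f ⁻¹' E.carrierᶜ) :=
    isCompact_Icc.inter_right (E.isOpen.isClosed_compl.preimage hfc)
  obtain ⟨τ, ⟨⟨hτ1, hτT⟩, hτ⟩, hleast⟩ := hK.exists_isLeast ⟨T, ⟨hT1, le_rfl⟩, hT⟩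
  have f1 : f 1 = w := by simp [hf]
  have hτ1' : 1 < τ := by
    refine lt_of_le_of_ne hτ1 fun he => hτ ?_
    rw [← he, f1]
    exact hw
  refine ⟨f τ, ⟨?_, ?_⟩, τ⁻¹, ⟨by positivity, inv_lt_one_of_one_lt₀ hτ1'⟩, ?_⟩
  · have ht : Tendsto f (𝓝[<] τ) (𝓝 (f τ)) := hfc.continuousAt.mono_left nhdsWithin_le_nhds
    refine mem_closure_of_tendsto ht ?_
    filter_upwards [Ioo_mem_nhdsLT hτ1'] with σ hσ
    by_contra hn
    exact absurd (hleast ⟨⟨hσ.1.le, hσ.2.le.trans hτT⟩, hn⟩) (not_le.2 hσ.2)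
  · rw [E.isOpen.interior_eq]
    exact hτ
  · simp [hf, AffineMap.lineMap_apply_module', smul_smul,
      inv_mul_cancel₀ (zero_lt_one.trans hτ1').ne']

lemma inner_normal_lineMap (E : Element) (k : Fin E.n) (s : ℝ) :
    inner ℝ (E.normal k) (AffineMap.lineMap (E.poly k) (E.poly (finRotate E.n k)) s : Plane) =
      inner ℝ (E.normal k) (E.poly k) := by
  rw [AffineMap.lineMap_apply_module', inner_add_right, inner_smul_right, E.normal_orthogonal]
  simp

/-- The ball lies on the inner side of every edge. -/
lemma IsStarBall.inner_normal_le (h : E.IsStarBall z r) (k : Fin E.n) {y : Plane}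
    (hy : y ∈ Metric.ball z r) : inner ℝ (E.normal k) y ≤ inner ℝ (E.normal k) (E.poly k) := by
  -- If `y` were strictly on the outer side, segments from `y` to points of the edge would cover the
  -- points just outside the midpoint `x`. Those segments lie in the polygon, contradicting that the
  -- normal is outer.
  by_contra! hlt
  set n := E.normal k with hn
  set p := E.poly k with hp
  set q := E.poly (finRotate E.n k) with hq
  set x : Plane := AffineMap.lineMap p q (1 / 2 : ℝ) with hx
  set δ : ℝ := inner ℝ n y - inner ℝ n p with hδ
  have hδ0 : 0 < δ := sub_pos.2 hlt
  have hxn : inner ℝ n x = inner ℝ n p := E.inner_normal_lineMap k _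
  have hnn : inner ℝ n n = (1 : ℝ) := by rw [real_inner_self_eq_norm_sq, E.norm_normal]; norm_num
  obtain ⟨α, hα⟩ : ∃ α : ℝ, y - x - δ • n = α • (q - p) := by
    have e1 := eq_smul_rot_of_inner_eq_zero (E.norm_normal k) (E.normal_orthogonal k)
    have e2 := eq_smul_rot_of_inner_eq_zero (n := n) (e := y - x - δ • n) (E.norm_normal k)
      (by rw [inner_sub_right, inner_sub_right, inner_smul_right, hxn, hnn, hδ]; ring)
    have hc : cross (q - p) n ≠ 0 := by
      intro h0
      rw [← hn, ← hp, ← hq, h0, zero_smul, sub_eq_zero] at e1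
      exact E.vertex_ne k e1.symm
    refine ⟨cross (y - x - δ • n) n / cross (q - p) n, ?_⟩
    calc y - x - δ • n = cross (y - x - δ • n) n • rot n := e2
      _ = (cross (y - x - δ • n) n / cross (q - p) n) • (cross (q - p) n • rot n) := by
        rw [smul_smul, div_mul_cancel₀ _ hc]
      _ = _ := by rw [hp, hq, hn, ← e1]
  have hxo : x ∈ openSegment ℝ p q := by
    rw [openSegment_eq_image_lineMap]
    exact ⟨1 / 2, by norm_num, rfl⟩
  -- This is the edge parameter of the point whose segment from `y` passes through `x + t • n`. It
  -- tends to `1 / 2`, so it stays in `[0, 1]` for small `t`.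
  have hcont : Tendsto (fun t : ℝ => 1 / 2 - (t / δ) / (1 - t / δ) * α) (𝓝[>] 0) (𝓝 (1 / 2)) := by
    have : ContinuousAt (fun t : ℝ => 1 / 2 - (t / δ) / (1 - t / δ) * α) 0 := by
      refine ContinuousAt.sub continuousAt_const (ContinuousAt.mul (ContinuousAt.div ?_ ?_ ?_)
        continuousAt_const)
      · fun_prop
      · fun_prop
      · simp
    have h2 := this.tendsto
    simp only [zero_div, zero_mul, sub_zero] at h2
    exact h2.mono_left nhdsWithin_le_nhds
  have hev := (E.normal_outer k x hxo).and ((hcont.eventually (Icc_mem_nhds (a := 0) (b := 1)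
    (by norm_num) (by norm_num))).and (Ioo_mem_nhdsGT hδ0))
  obtain ⟨t, ⟨-, hout⟩, hs, ht0, htδ⟩ := hev.exists
  refine hout (subset_closure ?_)
  have h1 : t / δ < 1 := (div_lt_one hδ0).2 htδ
  have h1' : 1 - t / δ ≠ 0 := by linarith
  have h0 : 0 < t / δ := div_pos ht0 hδ0
  have hm := h.lineMap_mem (frontier_subset_closure
    (E.edgeSet_subset_frontier k (E.lineMap_mem_edgeSet k hs))) hy (t := 1 - t / δ)
    ⟨by linarith, by linarith⟩
  convert hm using 1
  rw [AffineMap.lineMap_apply_module, ← hp, ← hq]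
  have e3 : (AffineMap.lineMap p q (1 / 2 - t / δ / (1 - t / δ) * α) : Plane) =
      x - (t / δ / (1 - t / δ)) • (y - x - δ • n) := by
    rw [hα, hx, AffineMap.lineMap_apply_module', AffineMap.lineMap_apply_module']
    module
  rw [e3, smul_sub, smul_smul, mul_div_cancel₀ _ h1', smul_sub, smul_sub, smul_smul,
    div_mul_cancel₀ _ hδ0.ne']
  module

/-- The preceding bound at the point `z + (r / 2) • n` of the ball. This uniform positivity drives
both the orientation argument and the trace inequality. -/
lemma IsStarBall.inner_normal_sub (h : E.IsStarBall z r) (k : Fin E.n) :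
    r / 2 ≤ inner ℝ (E.normal k) (E.poly k - z) := by
  have hr := h.pos
  have hy : z + (r / 2) • E.normal k ∈ Metric.ball z r := by
    rw [mem_ball_iff_norm, add_sub_cancel_left, norm_smul, E.norm_normal, Real.norm_eq_abs,
      abs_of_pos (by positivity)]
    linarith
  have := h.inner_normal_le k hy
  rw [inner_add_right, inner_smul_right, real_inner_self_eq_norm_sq, E.norm_normal] at this
  rw [inner_sub_right]
  linarith

/-- The orientation of the triangle spanned by `z` and the `k`-th edge. -/
def orient (E : Element) (z : Plane) (k : Fin E.n) : ℝ :=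
  cross (E.poly k - z) (E.poly (finRotate E.n k) - z)

/-- The sign σ is that of the oriented area of the triangle. Since `z` lies strictly on the inner
side of the edge, the same sign makes the rotated edge vector point outwards, so it becomes the edge
length times the outer normal. -/
lemma IsStarBall.exists_sign (h : E.IsStarBall z r) (k : Fin E.n) :
    ∃ σ : ℝ, (σ = 1 ∨ σ = -1) ∧ 0 < σ * E.orient z k ∧
      ∀ m, σ * rot (E.poly (finRotate E.n k) - E.poly k) m =
        dist (E.poly k) (E.poly (finRotate E.n k)) * E.normal k m := by
  set n := E.normal k
  set e := E.poly (finRotate E.n k) - E.poly k with he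
  have e1 : e = cross e n • rot n :=
    eq_smul_rot_of_inner_eq_zero (E.norm_normal k) (E.normal_orthogonal k)
  have hn1 : n 0 ^ 2 + n 1 ^ 2 = 1 := by rw [← norm_sq_plane, E.norm_normal]; norm_num
  have hd : dist (E.poly k) (E.poly (finRotate E.n k)) = |cross e n| := by
    rw [dist_comm, dist_eq_norm, ← he]
    conv_lhs => rw [e1, norm_smul, Real.norm_eq_abs]
    have : ‖rot n‖ ^ 2 = 1 := by rw [norm_sq_plane]; simp [rot]; linarith
    rw [(pow_eq_one_iff_of_nonneg (norm_nonneg _) two_ne_zero).1 this, mul_one]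
  have hpos := h.inner_normal_sub k
  have hr := h.pos
  have ho : E.orient z k = - cross e n * inner ℝ n (E.poly k - z) := by
    have : E.orient z k = (E.poly k - z) 0 * e 1 - (E.poly k - z) 1 * e 0 := by
      simp [orient, cross, he]; ring
    rw [this, inner_plane]
    conv_lhs => rw [e1]
    simp [rot]; ring
  have hc : cross e n ≠ 0 := by
    intro h0
    rw [h0, zero_smul, he, sub_eq_zero] at e1
    exact E.vertex_ne k e1.symm
  have hrot : ∀ m, rot e m = - cross e n * n m := by
    intro m
    have hc : ∀ c : ℝ, rot (c • rot n) m = -c * n m := by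
      intro c
      fin_cases m <;> simp [rot]
    rw [← hc, ← e1]
  rcases lt_or_gt_of_ne hc with h0 | h0
  · refine ⟨1, Or.inl rfl, ?_, fun m => ?_⟩
    · rw [ho]; nlinarith
    · rw [hrot, hd, abs_of_neg h0]; ring
  · refine ⟨-1, Or.inr rfl, ?_, fun m => ?_⟩
    · rw [ho]; nlinarith
    · rw [hrot, hd, abs_of_pos h0]; ring

lemma lineMap_notMem_vertices (E : Element) (k : Fin E.n) {s : ℝ} (hs : s ∈ Ioo (0 : ℝ) 1) :
    (AffineMap.lineMap (E.poly k) (E.poly (finRotate E.n k)) s : Plane) ∉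
      ({E.poly k, E.poly (finRotate E.n k)} : Set Plane) := by
  rintro (h | h)
  · rcases AffineMap.lineMap_eq_left_iff.1 h with h | h
    · exact E.vertex_ne k h
    · exact hs.1.ne' h
  · rcases AffineMap.lineMap_eq_right_iff.1 h with h | h
    · exact E.vertex_ne k h
    · exact hs.2.ne h

lemma lineMap_notMem_edgeSet (E : Element) {k l : Fin E.n} (hkl : k ≠ l) {s : ℝ}
    (hs : s ∈ Ioo (0 : ℝ) 1) :
    (AffineMap.lineMap (E.poly k) (E.poly (finRotate E.n k)) s : Plane) ∉ E.poly.edgeSet ℝ l :=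
  fun h => E.lineMap_notMem_vertices k hs
    (E.simple k l hkl ⟨E.lineMap_mem_edgeSet k ⟨hs.1.le, hs.2.le⟩, h⟩).1

/-- Consecutive triangles have the same orientation. -/
lemma IsStarBall.orient_mul_orient_pos (h : E.IsStarBall z r) (k : Fin E.n) :
    0 < E.orient z k * E.orient z (finRotate E.n k) := by
  have ne0 : ∀ k, E.orient z k ≠ 0 := fun k h0 => by
    obtain ⟨σ, -, h1, -⟩ := h.exists_sign k
    rw [h0, mul_zero] at h1
    exact h1.false
  by_contra hneg
  set a := E.poly (finRotate E.n k) - z with ha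
  set b := E.poly k - z with hb
  set c := E.poly (finRotate E.n (finRotate E.n k)) - z with hc
  have ho1 : E.orient z k = - cross a b := by simp only [orient, cross, ha, hb]; ring
  have ho2 : E.orient z (finRotate E.n k) = cross a c := rfl
  have hab : cross a b ≠ 0 := fun h0 => ne0 k (by rw [ho1, h0, neg_zero])
  have hac : cross a c ≠ 0 := fun h0 => ne0 _ (by rw [ho2, h0])
  have hprod : 0 < cross a c * cross a b := by
    rw [ho1, ho2] at hneg
    rcases lt_or_gt_of_ne (mul_ne_zero hac hab) with h1 | h1
    · exact absurd (by linarith [mul_comm (cross a c) (cross a b)]) hneg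
    · exact h1
  -- Coordinates of `c` in the basis `a`, `b`. Opposite orientations would mean `μ > 0`: the next
  -- edge leaves its initial vertex towards the side, relative to the line through `z`, on which
  -- edge `k` lies.
  set μ := cross a c / cross a b with hμ
  set lam := cross c b / cross a b with hlam
  have hμ0 : 0 < μ := by
    rw [hμ, ← mul_div_mul_right _ _ hab]
    exact div_pos hprod (mul_self_pos.2 hab)
  have hcab : c = lam • a + μ • b := by
    ext i
    have : cross a b * c i = cross c b * a i + cross a c * b i := by
      fin_cases i <;> simp [cross] <;> ring
    simp only [PiLp.add_apply, PiLp.smul_apply, smul_eq_mul, hlam, hμ]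
    field_simp
    linarith
  -- A point of the next edge so close to the common vertex that its coefficient `1 - s + s * lam`
  -- along `a` is at least `1 / 2`. Both coefficients are then positive, and dividing by their sum
  -- `τ` gives an interior point of edge `k` on the same ray.
  set s : ℝ := 1 / (2 * (1 + |lam|)) with hs
  have hs0 : 0 < s := by positivity
  have hs1 : s * (1 + |lam|) = 1 / 2 := by rw [hs]; field_simp
  have habs := abs_nonneg lam
  have hs2 : s < 1 := by nlinarith
  have hA : 0 < 1 - s + s * lam := by nlinarith [neg_abs_le lam]
  have hB : 0 < s * μ := mul_pos hs0 hμ0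
  set τ := (1 - s + s * lam) + s * μ with hτ
  have hτ0 : 0 < τ := by positivity
  have hu : (1 - s + s * lam) / τ ∈ Ioo (0 : ℝ) 1 := ⟨by positivity, (div_lt_one hτ0).2 (by linarith)⟩
  have hx := E.lineMap_mem_edgeSet k ⟨hu.1.le, hu.2.le⟩
  have hy := E.lineMap_mem_edgeSet (finRotate E.n k) ⟨hs0.le, hs2.le⟩
  have hne : k ≠ finRotate E.n k :=
    (finRotate_ne (by have := E.three_le; omega) k).symm
  refine E.lineMap_notMem_edgeSet hne hu ?_
  -- A ray meets the boundary only once, so the two points coincide; but an interior point of edge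
  -- `k` lies on no other edge.
  rw [← h.eq_of_mem_ray (c := τ) (E.edgeSet_subset_frontier _ hy) (E.edgeSet_subset_frontier _ hx)
    hτ0 ?_]
  · exact hy
  · have e1 : (AffineMap.lineMap (E.poly k) (E.poly (finRotate E.n k))
        ((1 - s + s * lam) / τ) : Plane) - z = (1 - (1 - s + s * lam) / τ) • b
          + ((1 - s + s * lam) / τ) • a := by
      rw [AffineMap.lineMap_apply_module, ha, hb]; module
    have e2 : (AffineMap.lineMap (E.poly (finRotate E.n k))
        (E.poly (finRotate E.n (finRotate E.n k))) s : Plane) - z = (1 - s) • a + s • c := by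
      rw [AffineMap.lineMap_apply_module, ha, hc]; module
    have e3 : τ • ((1 - (1 - s + s * lam) / τ) • b + ((1 - s + s * lam) / τ) • a) =
        (τ - (1 - s + s * lam)) • b + (1 - s + s * lam) • a := by
      rw [smul_add, smul_smul, smul_smul, mul_sub, mul_div_cancel₀ _ hτ0.ne', mul_one]
    rw [e1, e2, e3, hcab, hτ]
    module

/-! ### The divergence theorem on a star-shaped polygon -/

/-- The triangle spanned by `z` and the `k`-th edge. -/
def tri (E : Element) (z : Plane) (k : Fin E.n) : Set Plane :=
  openTri z (E.poly k) (E.poly (finRotate E.n k))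

lemma IsStarBall.tri_subset (h : E.IsStarBall z r) (k : Fin E.n) : E.tri z k ⊆ E.carrier := by
  intro w hw
  obtain ⟨s, hs, t, ht, rfl⟩ := mem_openTri_iff.1 hw
  exact h.lineMap_mem (frontier_subset_closure
    (E.edgeSet_subset_frontier k (E.lineMap_mem_edgeSet k ⟨hs.1.le, hs.2.le⟩)))
    h.center_mem ⟨ht.1.le, ht.2⟩

/-- A common point of two triangles would put interior points of two edges on one ray; these would
coincide, against the simplicity of the polygon. -/
lemma IsStarBall.pairwise_disjoint_tri (h : E.IsStarBall z r) :
    Pairwise (Function.onFun Disjoint (E.tri z)) := by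
  intro k l hkl
  refine Set.disjoint_left.2 fun w hk hl => ?_
  obtain ⟨s, hs, t, ht, hw⟩ := mem_openTri_iff.1 hk
  obtain ⟨s', hs', t', ht', hw'⟩ := mem_openTri_iff.1 hl
  have hx := E.lineMap_mem_edgeSet k ⟨hs.1.le, hs.2.le⟩
  have hy := E.lineMap_mem_edgeSet l ⟨hs'.1.le, hs'.2.le⟩
  refine E.lineMap_notMem_edgeSet hkl hs ?_
  rw [h.eq_of_mem_ray (c := t' / t) (E.edgeSet_subset_frontier _ hx)
    (E.edgeSet_subset_frontier _ hy) (div_pos ht'.1 ht.1) ?_]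
  · exact hy
  · have e : t • ((AffineMap.lineMap (E.poly k) (E.poly (finRotate E.n k)) s : Plane) - z) =
        t' • ((AffineMap.lineMap (E.poly l) (E.poly (finRotate E.n l)) s' : Plane) - z) := by
      have := hw.symm.trans hw'
      rw [AffineMap.lineMap_apply_module', AffineMap.lineMap_apply_module' z] at this
      exact add_right_cancel this
    rw [div_eq_inv_mul, mul_smul, ← e, smul_smul, inv_mul_cancel₀ ht.1.ne', one_smul]

/-- Every point other than `z` lies on a segment from `z` to a boundary point. It is missed by the
open triangles only if that boundary point is a vertex, and the lines through `z` and the vertices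
are null sets. -/
lemma IsStarBall.ae_eq_iUnion_tri (h : E.IsStarBall z r) :
    E.carrier =ᵐ[volume] ⋃ k, E.tri z k := by
  refine (ae_le_set.2 ?_).antisymm (iUnion_subset h.tri_subset).eventuallyLE
  have hsub : E.carrier \ ⋃ k, E.tri z k ⊆ ⋃ k, (line[ℝ, z, E.poly k] : Set Plane) := by
    rintro w ⟨hw, hn⟩
    by_cases hwz : w = z
    · exact mem_iUnion.2 ⟨⟨0, by have := E.three_le; omega⟩,
        by rw [hwz]; exact left_mem_affineSpan_pair ℝ _ _⟩
    obtain ⟨x, hx, t, ht, rfl⟩ := E.exists_frontier_of_mem hw hwz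
    rw [E.frontier_eq] at hx
    obtain ⟨k, s, hs, rfl⟩ := mem_iUnion.1 hx
    rcases hs.1.eq_or_lt with rfl | hs0
    · rw [AffineMap.lineMap_apply_zero]
      exact mem_iUnion.2 ⟨k, AffineMap.lineMap_mem_affineSpan_pair _ _ _⟩
    rcases hs.2.eq_or_lt with rfl | hs1
    · rw [AffineMap.lineMap_apply_one]
      exact mem_iUnion.2 ⟨finRotate E.n k, AffineMap.lineMap_mem_affineSpan_pair _ _ _⟩
    exact absurd (mem_iUnion.2 ⟨k, mem_openTri_iff.2 ⟨s, ⟨hs0, hs1⟩, t, ht, rfl⟩⟩) hn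
  exact measure_mono_null hsub (measure_iUnion_null fun k => volume_line_eq_zero _ _)

lemma IsStarBall.measurableSet_tri (h : E.IsStarBall z r) (k : Fin E.n) : MeasurableSet (E.tri z k) := by
  obtain ⟨σ, -, h1, -⟩ := h.exists_sign k
  have hne : cross (E.poly k - z) (E.poly (finRotate E.n k) - z) ≠ 0 := fun h0 => by
    rw [orient, h0, mul_zero] at h1
    exact h1.false
  exact measurable_image_of_fderivWithin isOpen_refTri.measurableSet
    (fun x _ => ((frameMap _ _).hasFDerivAt.const_add z).hasFDerivWithinAt)
    (fun x _ y _ hxy => frameMap_injective hne (add_left_cancel hxy))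

lemma integrableOn_of_continuous (E : Element) {f : Plane → ℂ} (hf : Continuous f) :
    IntegrableOn f E.carrier :=
  (hf.continuousOn.integrableOn_compact E.isBounded.isCompact_closure).mono_set subset_closure

/-- The triangle formulas are added up. With a common orientation each segment from `z` to a vertex
is traversed once in each direction, so only the boundary edges survive. -/
theorem IsStarBall.setIntegral_pd (h : E.IsStarBall z r) {φ : Plane → ℂ} (hφ : ContDiff ℝ 1 φ)
    (m : Fin 2) : ∫ x in E.carrier, pd m φ x =
      ∑ k, (E.normal k m : ℂ) * edgeInt (E.poly.edgePath ℝ k) φ := by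
  have hcont : Continuous (pd m φ) := by
    have hc := hφ.continuous_fderiv one_ne_zero
    unfold pd
    fun_prop
  choose σ hσ1 hσ2 hσ3 using h.exists_sign
  have hσc : ∀ k, σ (finRotate E.n k) = σ k := by
    intro k
    have h1 := h.orient_mul_orient_pos k
    have h2 := hσ2 k
    have h3 := hσ2 (finRotate E.n k)
    rcases hσ1 k with e | e <;> rcases hσ1 (finRotate E.n k) with e' | e' <;> rw [e] at h2 ⊢ <;>
      rw [e'] at h3 ⊢ <;> nlinarith
  rw [setIntegral_congr_set h.ae_eq_iUnion_tri,
    integral_iUnion_fintype (fun k => h.measurableSet_tri k) h.pairwise_disjoint_tri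
      (fun k => (E.integrableOn_of_continuous hcont).mono_set (h.tri_subset k))]
  -- The second inner flux is written with the sign at `finRotate E.n k`, so that it is the cyclic
  -- shift of the first and the sum over `k` vanishes.
  have hk : ∀ k, ∫ x in E.tri z k, pd m φ x =
      (E.normal k m : ℂ) * edgeInt (E.poly.edgePath ℝ k) φ + (σ k * segFlux φ m z (E.poly k)
        - σ (finRotate E.n k) * segFlux φ m z (E.poly (finRotate E.n k))) := by
    intro k
    have hne : cross (E.poly k - z) (E.poly (finRotate E.n k) - z) ≠ 0 := fun h0 => by
      have h1 := hσ2 k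
      rw [orient, h0, mul_zero] at h1
      exact h1.false
    have habs : |cross (E.poly k - z) (E.poly (finRotate E.n k) - z)| =
        σ k * cross (E.poly k - z) (E.poly (finRotate E.n k) - z) := by
      have h1 := hσ2 k
      rw [orient] at h1
      rw [← abs_of_pos h1, abs_mul]
      rcases hσ1 k with e | e <;> simp [e]
    rw [tri, setIntegral_openTri hne, habs, Complex.real_smul, Complex.ofReal_mul, mul_assoc,
      cross_mul_setIntegral_refTri hφ, hσc]
    have e1 : (σ k : ℂ) * segFlux φ m (E.poly k) (E.poly (finRotate E.n k)) =
        (E.normal k m : ℂ) * edgeInt (E.poly.edgePath ℝ k) φ := by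
      have h4 : ((σ k : ℂ) * (rot (E.poly (finRotate E.n k) - E.poly k) m : ℂ)) =
          (dist (E.poly k) (E.poly (finRotate E.n k)) : ℂ) * E.normal k m := by
        exact_mod_cast hσ3 k m
      rw [segFlux, ← mul_assoc, h4, edgeInt, segInt, Polygon.edgePath, AffineMap.lineMap_apply_zero,
        AffineMap.lineMap_apply_one]
      ring
    rw [← e1]
    ring
  simp only [hk]
  rw [Finset.sum_add_distrib, Finset.sum_sub_distrib,
    Equiv.sum_comp (finRotate E.n) (fun k => (σ k : ℂ) * segFlux φ m z (E.poly k)), sub_self,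
    add_zero]

end Element

/-! ### Convergence in `L²` -/

/-- Hölder's inequality gives convergence of the products in `L¹`. Only one factor varies, so double
limits are taken one variable at a time. -/
lemma tendsto_integral_mul_of_tendsto_eLpNorm {α : Type*} [MeasurableSpace α] {μ : Measure α}
    {F : ℕ → α → ℂ} {f g : α → ℂ} (hF : ∀ n, MemLp (F n) 2 μ) (hf : MemLp f 2 μ)
    (hg : MemLp g 2 μ)
    (h : Tendsto (fun n => eLpNorm (fun x => F n x - f x) 2 μ) atTop (𝓝 0)) :
    Tendsto (fun n => ∫ x, F n x * g x ∂μ) atTop (𝓝 (∫ x, f x * g x ∂μ)) := by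
  refine tendsto_integral_of_L1 _ (hf.integrable_mul hg).aestronglyMeasurable
    (Eventually.of_forall fun n => (hF n).integrable_mul hg) ?_
  have hle : ∀ n, ∫⁻ x, ‖F n x * g x - f x * g x‖ₑ ∂μ ≤
      eLpNorm (fun x => F n x - f x) 2 μ * eLpNorm g 2 μ := by
    intro n
    have := eLpNorm_smul_le_mul_eLpNorm (p := 2) (q := 2) (r := 1) hg.aestronglyMeasurable
      ((hF n).sub hf).aestronglyMeasurable
    rw [eLpNorm_one_eq_lintegral_enorm] at this
    refine le_trans (le_of_eq ?_) this
    refine lintegral_congr fun x => ?_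
    simp only [Pi.smul_apply', Pi.sub_apply, smul_eq_mul, sub_mul]
  refine tendsto_of_tendsto_of_tendsto_of_le_of_le tendsto_const_nhds ?_ (fun n => zero_le) hle
  simpa using ENNReal.Tendsto.mul_const h (Or.inr hg.eLpNorm_ne_top)

lemma memLp_conj {α : Type*} [MeasurableSpace α] {μ : Measure α} {f : α → ℂ} (hf : MemLp f 2 μ) :
    MemLp (fun x => conj (f x)) 2 μ := hf.star

lemma memLp_of_continuous {U : Set Plane} (hU : Bornology.IsBounded U) {f : Plane → ℂ}
    (hf : Continuous f) : MemLp f 2 (volume.restrict U) := by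
  have hK := hU.isCompact_closure
  obtain ⟨C, hC⟩ := hK.exists_bound_of_continuousOn hf.continuousOn
  have : IsFiniteMeasure (volume.restrict (closure U)) := ⟨by simpa using hK.measure_lt_top⟩
  refine MemLp.mono_measure (Measure.restrict_mono subset_closure le_rfl)
    (MemLp.of_bound hf.aestronglyMeasurable C ?_)
  exact (ae_restrict_iff' isClosed_closure.measurableSet).2 (Eventually.of_forall hC)

/-! ### Weak derivatives -/

lemma integrable_ofReal_mul {μ : Measure Plane} [IsFiniteMeasureOnCompacts μ] {φ : Plane → ℝ}
    {v : Plane → ℂ} (hφ : Continuous φ) (hs : HasCompactSupport φ) (hv : MemLp v 2 μ) :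
    Integrable (fun x => (φ x : ℂ) * v x) μ := by
  have : MemLp (fun x => (φ x : ℂ)) 2 μ :=
    (hφ.memLp_of_hasCompactSupport hs : MemLp φ 2 μ).ofReal
  exact this.integrable_mul hv

lemma continuous_fderiv_apply {F : Type*} [NormedAddCommGroup F] [NormedSpace ℝ F]
    {φ : Plane → F} (hφ : ContDiff ℝ ∞ φ) (y : Plane) : Continuous fun x => fderiv ℝ φ x y := by
  have := hφ.continuous_fderiv (by simp)
  fun_prop

lemma continuous_pd {φ : Plane → ℂ} (hφ : ContDiff ℝ ∞ φ) (i : Fin 2) : Continuous (pd i φ) :=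
  continuous_fderiv_apply hφ _

variable {U : Set Plane} {v w g g' : Plane → ℂ} {i : Fin 2}

/-- The fundamental lemma of the calculus of variations applied to `g - g'`. It makes the choice
inside `weakPartial` harmless. -/
lemma HasWeakPartial.ae_eq (hU : IsOpen U) (hg : MemLp g 2 (volume.restrict U))
    (hg' : MemLp g' 2 (volume.restrict U)) (h : HasWeakPartial U v i g)
    (h' : HasWeakPartial U v i g') : g =ᵐ[volume.restrict U] g' := by
  have hsub := hg.sub hg'
  have hloc : LocallyIntegrableOn (g - g') U volume := by
    rw [locallyIntegrableOn_iff hU.isLocallyClosed]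
    intro K hKU hK
    have : IsFiniteMeasure (volume.restrict K) := ⟨by simpa using hK.measure_lt_top⟩
    exact (MemLp.mono_measure (Measure.restrict_mono hKU le_rfl) hsub).integrable (by norm_num)
  have := hU.ae_eq_zero_of_integral_contDiff_smul_eq_zero hloc (fun φ h1 h2 h3 => ?_)
  · refine (ae_restrict_iff' hU.measurableSet).2 (this.mono fun x hx hxU => ?_)
    exact sub_eq_zero.1 (hx hxU)
  · have e1 := h φ h1 h2 h3
    have e2 := h' φ h1 h2 h3
    rw [e1, neg_inj] at e2
    have e3 : ∫ x, φ x • (g - g') x = ∫ x in U, φ x • (g - g') x := by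
      rw [setIntegral_eq_integral_of_forall_compl_eq_zero]
      intro x hx
      rw [image_eq_zero_of_notMem_tsupport (fun hm => hx (h3 hm)), zero_smul]
    rw [e3]
    simp only [Pi.sub_apply, Complex.real_smul, mul_sub]
    rw [integral_sub (integrable_ofReal_mul h1.continuous h2 hg)
      (integrable_ofReal_mul h1.continuous h2 hg'), e2, sub_self]

lemma MemH1.memLp_weakPartial (hv : MemH1 U v) (i : Fin 2) :
    MemLp (weakPartial U v i) 2 (volume.restrict U) := by
  rw [weakPartial, dif_pos (hv.2 i)]
  exact (hv.2 i).choose_spec.1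

lemma MemH1.hasWeakPartial (hv : MemH1 U v) (i : Fin 2) :
    HasWeakPartial U v i (weakPartial U v i) := by
  rw [weakPartial, dif_pos (hv.2 i)]
  exact (hv.2 i).choose_spec.2

lemma HasWeakPartial.weakPartial_ae_eq (hU : IsOpen U) (hg : MemLp g 2 (volume.restrict U))
    (h : HasWeakPartial U v i g) : weakPartial U v i =ᵐ[volume.restrict U] g := by
  have hex : ∃ g : Plane → ℂ, MemLp g 2 (volume.restrict U) ∧ HasWeakPartial U v i g := ⟨g, hg, h⟩
  rw [weakPartial, dif_pos hex]
  exact hex.choose_spec.2.ae_eq hU hex.choose_spec.1 hg h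

lemma HasWeakPartial.mono {W : Set Plane} (hU : MeasurableSet U)
    (hWU : W ⊆ U) (h : HasWeakPartial U v i g) :
    HasWeakPartial W v i g := by
  intro φ h1 h2 h3
  have e := h φ h1 h2 (h3.trans hWU)
  have key : ∀ (ψ : Plane → ℝ) (f : Plane → ℂ), (∀ x, x ∉ tsupport φ → ψ x = 0) →
      ∫ x in W, (ψ x : ℂ) * f x = ∫ x in U, (ψ x : ℂ) * f x := by
    intro ψ f hψ
    refine (setIntegral_eq_of_subset_of_forall_sdiff_eq_zero hU hWU fun x hx => ?_).symm
    rw [hψ x (fun hm => hx.2 (h3 hm)), Complex.ofReal_zero, zero_mul]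
  rw [key (fun x => fderiv ℝ φ x (unitVec i)) v, key φ g, e]
  · exact fun x hx => image_eq_zero_of_notMem_tsupport hx
  · intro x hx
    have : fderiv ℝ φ x = 0 :=
      image_eq_zero_of_notMem_tsupport (fun hm => hx (tsupport_fderiv_subset ℝ hm))
    rw [this]; rfl

lemma MemH1.mono {W : Set Plane} (hU : MeasurableSet U)
    (hWU : W ⊆ U) (h : MemH1 U v) : MemH1 W v :=
  ⟨h.1.mono_measure (Measure.restrict_mono hWU le_rfl), fun i => ⟨weakPartial U v i,
    (h.memLp_weakPartial i).mono_measure (Measure.restrict_mono hWU le_rfl),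
    (h.hasWeakPartial i).mono hU hWU⟩⟩

lemma MemH1.weakPartial_mono_ae_eq {W : Set Plane} (hW : IsOpen W) (hU : IsOpen U)
    (hWU : W ⊆ U) (h : MemH1 U v) (i : Fin 2) :
    weakPartial W v i =ᵐ[volume.restrict W] weakPartial U v i :=
  ((h.hasWeakPartial i).mono hU.measurableSet hWU).weakPartial_ae_eq hW
    ((h.memLp_weakPartial i).mono_measure (Measure.restrict_mono hWU le_rfl))

lemma HasWeakPartial.sub (hv : MemLp v 2 (volume.restrict U)) (hw : MemLp w 2 (volume.restrict U))
    (hg : MemLp g 2 (volume.restrict U)) (hg' : MemLp g' 2 (volume.restrict U))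
    (h : HasWeakPartial U v i g) (h' : HasWeakPartial U w i g') :
    HasWeakPartial U (v - w) i (g - g') := by
  intro φ h1 h2 h3
  have hc := continuous_fderiv_apply h1 (unitVec i)
  have hs : HasCompactSupport fun x => fderiv ℝ φ x (unitVec i) := h2.fderiv_apply ℝ _
  simp only [Pi.sub_apply, mul_sub]
  rw [integral_sub (integrable_ofReal_mul hc hs hv) (integrable_ofReal_mul hc hs hw),
    integral_sub (integrable_ofReal_mul h1.continuous h2 hg)
      (integrable_ofReal_mul h1.continuous h2 hg'), h φ h1 h2 h3, h' φ h1 h2 h3]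
  ring

/-- The test functions are real, so the defining identity may simply be conjugated. -/
lemma HasWeakPartial.cj (h : HasWeakPartial U v i g) : HasWeakPartial U (cj v) i (cj g) := by
  intro φ h1 h2 h3
  have := congrArg conj (h φ h1 h2 h3)
  rw [map_neg, ← integral_conj, ← integral_conj] at this
  simpa [VEM.cj] using this

lemma MemH1.sub (hv : MemH1 U v) (hw : MemH1 U w) : MemH1 U (v - w) :=
  ⟨hv.1.sub hw.1, fun i => ⟨_, (hv.memLp_weakPartial i).sub (hw.memLp_weakPartial i),
    (hv.hasWeakPartial i).sub hv.1 hw.1 (hv.memLp_weakPartial i) (hw.memLp_weakPartial i)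
      (hw.hasWeakPartial i)⟩⟩

lemma MemH1.weakPartial_sub_ae_eq (hU : IsOpen U) (hv : MemH1 U v) (hw : MemH1 U w) (i : Fin 2) :
    weakPartial U (v - w) i =ᵐ[volume.restrict U] weakPartial U v i - weakPartial U w i :=
  ((hv.hasWeakPartial i).sub hv.1 hw.1 (hv.memLp_weakPartial i) (hw.memLp_weakPartial i)
    (hw.hasWeakPartial i)).weakPartial_ae_eq hU
      ((hv.memLp_weakPartial i).sub (hw.memLp_weakPartial i))

lemma MemH1.cj (hv : MemH1 U v) : MemH1 U (cj v) :=
  ⟨memLp_conj hv.1, fun i => ⟨_, memLp_conj (hv.memLp_weakPartial i), (hv.hasWeakPartial i).cj⟩⟩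

lemma MemH1.weakPartial_cj_ae_eq (hU : IsOpen U) (hv : MemH1 U v) (i : Fin 2) :
    weakPartial U (VEM.cj v) i =ᵐ[volume.restrict U] VEM.cj (weakPartial U v i) :=
  (hv.hasWeakPartial i).cj.weakPartial_ae_eq hU (memLp_conj (hv.memLp_weakPartial i))

lemma hasWeakPartial_of_contDiff {p : Plane → ℂ} (hp : ContDiff ℝ ∞ p) (U : Set Plane)
    (i : Fin 2) : HasWeakPartial U p i (pd i p) := by
  intro φ h1 h2 h3
  have hφc : ContDiff ℝ ∞ fun x => (φ x : ℂ) := Complex.ofRealCLM.contDiff.comp h1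
  have hsc : HasCompactSupport fun x => (φ x : ℂ) := h2.comp_left (g := Complex.ofReal) rfl
  have hfd : ∀ x, fderiv ℝ (fun x => (φ x : ℂ)) x (unitVec i) = (fderiv ℝ φ x (unitVec i) : ℝ) := by
    intro x
    have := (Complex.ofRealCLM.hasFDerivAt.comp x (h1.differentiable (by simp) x).hasFDerivAt).fderiv
    exact congrArg (fun L : Plane →L[ℝ] ℂ => L (unitVec i)) this
  have hs' : HasCompactSupport fun x => fderiv ℝ φ x (unitVec i) := h2.fderiv_apply ℝ _
  have hs'' : HasCompactSupport fun x => ((fderiv ℝ φ x (unitVec i) : ℝ) : ℂ) :=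
    hs'.comp_left (g := Complex.ofReal) rfl
  have e := integral_mul_fderiv_eq_neg_fderiv_mul_of_integrable (μ := (volume : Measure Plane))
    (f := fun x => (φ x : ℂ)) (g := p) (v := unitVec i)
    (by
      simp only [hfd]
      refine Continuous.integrable_of_hasCompactSupport ?_ hs''.mul_right
      exact (Complex.continuous_ofReal.comp (continuous_fderiv_apply h1 _)).mul hp.continuous)
    (by
      refine Continuous.integrable_of_hasCompactSupport ?_ hsc.mul_right
      exact hφc.continuous.mul (continuous_pd hp i))
    (by
      refine Continuous.integrable_of_hasCompactSupport ?_ hsc.mul_right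
      exact hφc.continuous.mul hp.continuous)
    (fun x _ => hφc.differentiable (by simp) x) (fun x _ => hp.differentiable (by simp) x)
  simp only [hfd] at e
  rw [setIntegral_eq_integral_of_forall_compl_eq_zero,
    setIntegral_eq_integral_of_forall_compl_eq_zero]
  · exact neg_eq_iff_eq_neg.1 e.symm
  · intro x hx
    rw [image_eq_zero_of_notMem_tsupport (fun hm => hx (h3 hm)), Complex.ofReal_zero, zero_mul]
  · intro x hx
    have : fderiv ℝ φ x = 0 :=
      image_eq_zero_of_notMem_tsupport (fun hm => hx (h3 (tsupport_fderiv_subset ℝ hm)))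
    simp [this]

lemma memH1_of_contDiff (hU : Bornology.IsBounded U) {p : Plane → ℂ} (hp : ContDiff ℝ ∞ p) :
    MemH1 U p :=
  ⟨memLp_of_continuous hU hp.continuous, fun i => ⟨pd i p,
    memLp_of_continuous hU (continuous_pd hp i), hasWeakPartial_of_contDiff hp U i⟩⟩

lemma weakPartial_of_contDiff_ae_eq (hU : IsOpen U) (hUb : Bornology.IsBounded U) {p : Plane → ℂ}
    (hp : ContDiff ℝ ∞ p) (i : Fin 2) : weakPartial U p i =ᵐ[volume.restrict U] pd i p :=
  (hasWeakPartial_of_contDiff hp U i).weakPartial_ae_eq hU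
    (memLp_of_continuous hUb (continuous_pd hp i))

/-! ### Affine functions -/

lemma contDiff_of_mem_P1 {p : Plane → ℂ} (hp : p ∈ P1) : ContDiff ℝ ∞ p := by
  obtain ⟨c, g, rfl⟩ := hp
  have : ∀ i : Fin 2, ContDiff ℝ ∞ fun x : Plane => ((x i : ℝ) : ℂ) := fun i =>
    Complex.ofRealCLM.contDiff.comp (EuclideanSpace.proj (𝕜 := ℝ) i).contDiff
  exact contDiff_const.add (ContDiff.sum fun i _ => contDiff_const.mul (this i))

lemma exists_pd_of_mem_P1 {p : Plane → ℂ} (hp : p ∈ P1) : ∃ g : Fin 2 → ℂ, ∀ i x, pd i p x = g i := by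
  obtain ⟨c, g, rfl⟩ := hp
  refine ⟨g, fun i x => ?_⟩
  have h1 : ∀ j : Fin 2, HasFDerivAt (fun x : Plane => g j * ((x j : ℝ) : ℂ))
      (g j • (Complex.ofRealCLM.comp (EuclideanSpace.proj (𝕜 := ℝ) j : Plane →L[ℝ] ℝ))) x := fun j =>
    (Complex.ofRealCLM.comp (EuclideanSpace.proj (𝕜 := ℝ) j : Plane →L[ℝ] ℝ)).hasFDerivAt.const_mul
      (g j)
  have h2 := ((HasFDerivAt.fun_sum (u := Finset.univ) fun j _ => h1 j).const_add c).fderiv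
  rw [pd, h2]
  fin_cases i <;> simp [Fin.sum_univ_two, unitVec]

lemma zero_mem_P1 : (0 : Plane → ℂ) ∈ P1 := ⟨0, 0, by funext x; simp⟩

lemma cj_mem_P1 {p : Plane → ℂ} (hp : p ∈ P1) : cj p ∈ P1 := by
  obtain ⟨c, g, rfl⟩ := hp
  exact ⟨conj c, fun i => conj (g i), by funext x; simp [cj]⟩

lemma Element.piNabla_mem_P1 (E : Element) (v : Plane → ℂ) : E.piNabla v ∈ P1 := by
  unfold Element.piNabla
  split_ifs with h
  · exact h.choose_spec.1
  · exact zero_mem_P1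

lemma Element.piZero_mem_P1 (E : Element) (v : Plane → ℂ) : E.piZero v ∈ P1 := by
  unfold Element.piZero
  split_ifs with h
  · exact h.choose_spec.1
  · exact zero_mem_P1

/-! ### Traces on the edges of a star-shaped polygon -/

lemma toReal_eLpNorm_sq {α : Type*} [MeasurableSpace α] {μ : Measure α} {f : α → ℂ}
    (hf : MemLp f 2 μ) : (eLpNorm f 2 μ).toReal ^ 2 = ∫ x, ‖f x‖ ^ 2 ∂μ := by
  rw [hf.eLpNorm_eq_integral_rpow_norm two_ne_zero ENNReal.ofNat_ne_top]
  have h0 : 0 ≤ ∫ x, ‖f x‖ ^ 2 ∂μ := integral_nonneg fun x => by positivity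
  simp only [ENNReal.toReal_ofNat, Real.rpow_ofNat]
  rw [ENNReal.toReal_ofReal (by positivity), ← Real.rpow_natCast, ← Real.rpow_mul h0]
  norm_num

lemma pd_sub {φ ψ : Plane → ℂ} (hφ : ContDiff ℝ ∞ φ) (hψ : ContDiff ℝ ∞ ψ) (i : Fin 2)
    (x : Plane) : pd i (fun y => φ y - ψ y) x = pd i φ x - pd i ψ x := by
  unfold pd
  rw [fderiv_fun_sub (hφ.differentiable (by simp) x) (hψ.differentiable (by simp) x)]
  rfl

lemma pd_cj {φ : Plane → ℂ} (hφ : ContDiff ℝ ∞ φ) (i : Fin 2)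
    (x : Plane) : pd i (cj φ) x = conj (pd i φ x) := by
  have := (Complex.conjCLE.toContinuousLinearMap.hasFDerivAt.comp x
    (hφ.differentiable (by simp) x).hasFDerivAt).fderiv
  exact congrArg (fun L : Plane →L[ℝ] ℂ => L (unitVec i)) this

lemma contDiff_cj {φ : Plane → ℂ} (hφ : ContDiff ℝ ∞ φ) : ContDiff ℝ ∞ (cj φ) :=
  Complex.conjCLE.toContinuousLinearMap.contDiff.comp hφ

lemma pd_mul {φ ψ : Plane → ℂ} (hφ : ContDiff ℝ ∞ φ) (hψ : ContDiff ℝ ∞ ψ) (i : Fin 2)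
    (x : Plane) : pd i (fun y => φ y * ψ y) x = φ x * pd i ψ x + pd i φ x * ψ x := by
  unfold pd
  rw [fderiv_fun_mul (hφ.differentiable (by simp) x) (hψ.differentiable (by simp) x)]
  simp [mul_comm]

lemma coord_sub_mem_P1 (z : Plane) (m : Fin 2) :
    (fun x : Plane => ((x m - z m : ℝ) : ℂ)) ∈ P1 := by
  refine ⟨-(z m : ℂ), fun i => if i = m then 1 else 0, ?_⟩
  funext x
  simp
  ring

lemma pd_coord_sub (z : Plane) (m : Fin 2) (x : Plane) :
    pd m (fun x : Plane => ((x m - z m : ℝ) : ℂ)) x = 1 := by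
  have h1 : HasFDerivAt (fun x : Plane => ((x m - z m : ℝ) : ℂ))
      (Complex.ofRealCLM.comp (EuclideanSpace.proj (𝕜 := ℝ) m : Plane →L[ℝ] ℝ)) x :=
    Complex.ofRealCLM.hasFDerivAt.comp x
      ((EuclideanSpace.proj (𝕜 := ℝ) m : Plane →L[ℝ] ℝ).hasFDerivAt.sub_const (z m))
  rw [pd, h1.fderiv]
  simp [unitVec]

namespace Element

variable {E : Element} {z : Plane} {r : ℝ}

lemma edgePath_apply (E : Element) (k : Fin E.n) (s : ℝ) : E.poly.edgePath ℝ k s =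
    AffineMap.lineMap (E.poly k) (E.poly (finRotate E.n k)) s := rfl

lemma memLp_comp_edgePath (E : Element) (k : Fin E.n) {φ : Plane → ℂ} (hφ : Continuous φ) :
    MemLp (fun s => φ (E.poly.edgePath ℝ k s)) 2 (volume.restrict (Icc (0 : ℝ) 1)) := by
  have hγ : Continuous fun s : ℝ => (E.poly.edgePath ℝ k s : Plane) := AffineMap.lineMap_continuous
  obtain ⟨B, hB⟩ := isCompact_Icc.exists_bound_of_continuousOn (s := Icc (0 : ℝ) 1)
    (hφ.comp hγ).continuousOn
  exact MemLp.of_bound (hφ.comp hγ).aestronglyMeasurable B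
    ((ae_restrict_iff' measurableSet_Icc).2 (Eventually.of_forall hB))

/-- The Rellich-type identity `∫_{∂E} (x - z)·n |φ|² = ∫_E div ((x - z) |φ|²)`. -/
lemma IsStarBall.sum_edge_sq (h : E.IsStarBall z r) {φ : Plane → ℂ} (hφ : ContDiff ℝ ∞ φ) :
    ((∑ k, dist (E.poly k) (E.poly (finRotate E.n k)) * (inner ℝ (E.normal k) (E.poly k - z) *
      ∫ s in (0 : ℝ)..1, ‖φ (E.poly.edgePath ℝ k s)‖ ^ 2) : ℝ) : ℂ) =
    ∫ x in E.carrier, ∑ m, (((x m - z m : ℝ) : ℂ) * (φ x * conj (pd m φ x) + pd m φ x * conj (φ x))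
      + φ x * conj (φ x)) := by
  have hX := fun m => contDiff_of_mem_P1 (coord_sub_mem_P1 z m)
  have hsq : ContDiff ℝ ∞ fun x => φ x * cj φ x := hφ.mul (contDiff_cj hφ)
  have hψ : ∀ m : Fin 2, ContDiff ℝ ∞ fun x : Plane => ((x m - z m : ℝ) : ℂ) * (φ x * cj φ x) :=
    fun m => (hX m).mul hsq
  have hpd : ∀ (m : Fin 2) (x : Plane),
      ((x m - z m : ℝ) : ℂ) * (φ x * conj (pd m φ x) + pd m φ x * conj (φ x)) + φ x * conj (φ x) =
        pd m (fun x : Plane => ((x m - z m : ℝ) : ℂ) * (φ x * cj φ x)) x := by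
    intro m x
    rw [pd_mul (hX m) hsq, pd_coord_sub, pd_mul hφ (contDiff_cj hφ), pd_cj hφ, one_mul, cj]
  simp only [hpd]
  rw [integral_finsetSum _ fun m _ => E.integrableOn_of_continuous (continuous_pd (hψ m) m)]
  simp only [fun m => h.setIntegral_pd ((hψ m).of_le (by norm_cast)) m]
  rw [Finset.sum_comm, Complex.ofReal_sum]
  refine Finset.sum_congr rfl fun k _ => ?_
  have hγ : Continuous fun s : ℝ => (E.poly.edgePath ℝ k s : Plane) := AffineMap.lineMap_continuous
  have h_int : ∀ m, IntervalIntegrable (fun s : ℝ => (E.normal k m : ℂ) *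
      (((E.poly.edgePath ℝ k s m - z m : ℝ) : ℂ) *
        (φ (E.poly.edgePath ℝ k s) * cj φ (E.poly.edgePath ℝ k s)))) volume 0 1 := fun m =>
    (continuous_const.mul ((hψ m).continuous.comp hγ)).intervalIntegrable _ _
  have hsum : ∑ m, (E.normal k m : ℂ) * edgeInt (E.poly.edgePath ℝ k)
      (fun x => ((x m - z m : ℝ) : ℂ) * (φ x * cj φ x)) =
      (dist (E.poly.edgePath ℝ k 0) (E.poly.edgePath ℝ k 1) : ℂ) *
        ∑ m, ∫ s in (0 : ℝ)..1, (E.normal k m : ℂ) * (((E.poly.edgePath ℝ k s m - z m : ℝ) : ℂ) *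
          (φ (E.poly.edgePath ℝ k s) * cj φ (E.poly.edgePath ℝ k s))) := by
    rw [Finset.mul_sum]
    refine Finset.sum_congr rfl fun m _ => ?_
    rw [edgeInt, intervalIntegral.integral_const_mul]
    ring
  rw [hsum, ← intervalIntegral.integral_finsetSum fun m _ => h_int m, Complex.ofReal_mul,
    Complex.ofReal_mul, ← intervalIntegral.integral_ofReal, ← intervalIntegral.integral_const_mul]
  congr 1
  · simp [edgePath_apply]
  congr 1
  funext s
  -- The quantity (x - z)·n is constant along an edge, so it may be evaluated at the vertex `E.poly
  -- k`.
  have hi : inner ℝ (E.normal k) (E.poly k - z) = ∑ m, E.normal k m *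
      (E.poly.edgePath ℝ k s m - z m) := by
    rw [inner_sub_right, ← E.inner_normal_lineMap k s, ← inner_sub_right, inner_plane,
      Fin.sum_univ_two]
    rfl
  rw [hi, Complex.ofReal_sum, Finset.sum_mul]
  refine Finset.sum_congr rfl fun m _ => ?_
  have : ((‖φ (E.poly.edgePath ℝ k s)‖ ^ 2 : ℝ) : ℂ) =
      φ (E.poly.edgePath ℝ k s) * cj φ (E.poly.edgePath ℝ k s) := by
    rw [cj, Complex.mul_conj, Complex.normSq_eq_norm_sq]
  rw [this]
  push_cast
  ring

/-- The trace inequality, for squared norms. -/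
lemma IsStarBall.exists_trace_sq_le (h : E.IsStarBall z r) (k : Fin E.n) :
    ∃ C : ℝ, 0 ≤ C ∧ ∀ φ : Plane → ℂ, ContDiff ℝ ∞ φ →
      ∫ s in (0 : ℝ)..1, ‖φ (E.poly.edgePath ℝ k s)‖ ^ 2 ≤
        C * ((∫ x in E.carrier, ‖φ x‖ ^ 2) + ∑ m, ∫ x in E.carrier, ‖pd m φ x‖ ^ 2) := by
  obtain ⟨R, hR⟩ := E.isBounded.subset_closedBall z
  set D := |R| with hD
  have hD0 : 0 ≤ D := abs_nonneg _
  have hcoord : ∀ x ∈ E.carrier, ∀ m, |x m - z m| ≤ D := fun x hx m => by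
    have h1 := hR hx
    rw [mem_closedBall_iff_norm] at h1
    have h2 := PiLp.norm_apply_le (x - z) m
    exact (h2.trans h1).trans (le_abs_self R)
  set w : ℝ := dist (E.poly k) (E.poly (finRotate E.n k)) * inner ℝ (E.normal k) (E.poly k - z)
  have hw : 0 < w := mul_pos (dist_pos.2 (E.vertex_ne k))
    (lt_of_lt_of_le (half_pos h.pos) (h.inner_normal_sub k))
  -- The `2` comes from the divergence of `x - z` in the plane, the `2 * D` from |x_m - z_m| ≤ D in
  -- both components together with 2ab ≤ a² + b².
  refine ⟨(2 + 2 * D) / w, by positivity, fun φ hφ => ?_⟩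
  have h_int : IntegrableOn (fun x => ‖φ x‖ ^ 2) E.carrier := by
    have := (memLp_of_continuous E.isBounded hφ.continuous).integrable_norm_pow (p := 2) two_ne_zero
    exact this
  have h_intm : ∀ m, IntegrableOn (fun x => ‖pd m φ x‖ ^ 2) E.carrier := fun m => by
    have := (memLp_of_continuous E.isBounded (continuous_pd hφ m)).integrable_norm_pow
      (p := 2) two_ne_zero
    exact this
  have hkey : w * ∫ s in (0 : ℝ)..1, ‖φ (E.poly.edgePath ℝ k s)‖ ^ 2 ≤
      ∫ x in E.carrier, (2 + 2 * D) * (‖φ x‖ ^ 2 + ∑ m, ‖pd m φ x‖ ^ 2) := by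
    -- All edges enter the Rellich identity with nonnegative terms, so a single one is bounded by
    -- the sum.
    have hnn : ∀ l, 0 ≤ dist (E.poly l) (E.poly (finRotate E.n l)) *
        (inner ℝ (E.normal l) (E.poly l - z) *
          ∫ s in (0 : ℝ)..1, ‖φ (E.poly.edgePath ℝ l s)‖ ^ 2) := fun l =>
      mul_nonneg dist_nonneg (mul_nonneg ((half_pos h.pos).le.trans (h.inner_normal_sub l))
        (intervalIntegral.integral_nonneg zero_le_one fun s _ => by positivity))
    calc w * ∫ s in (0 : ℝ)..1, ‖φ (E.poly.edgePath ℝ k s)‖ ^ 2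
        ≤ ∑ l, dist (E.poly l) (E.poly (finRotate E.n l)) * (inner ℝ (E.normal l) (E.poly l - z) *
          ∫ s in (0 : ℝ)..1, ‖φ (E.poly.edgePath ℝ l s)‖ ^ 2) := by
          rw [mul_assoc]
          exact Finset.single_le_sum (fun l _ => hnn l) (Finset.mem_univ k)
      _ ≤ ‖((∑ l, dist (E.poly l) (E.poly (finRotate E.n l)) *
          (inner ℝ (E.normal l) (E.poly l - z) *
          ∫ s in (0 : ℝ)..1, ‖φ (E.poly.edgePath ℝ l s)‖ ^ 2) : ℝ) : ℂ)‖ := by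
          rw [Complex.norm_real]; exact Real.le_norm_self _
      _ ≤ _ := by
        rw [h.sum_edge_sq hφ]
        refine norm_integral_le_of_norm_le ((h_int.add
          (integrable_finsetSum _ fun m _ => h_intm m)).const_mul _) ?_
        refine (ae_restrict_iff' E.isOpen.measurableSet).2 (Eventually.of_forall fun x hx => ?_)
        have hm : ∀ m, ‖((x m - z m : ℝ) : ℂ) * (φ x * conj (pd m φ x) + pd m φ x * conj (φ x))
            + φ x * conj (φ x)‖ ≤ D * (‖φ x‖ ^ 2 + ‖pd m φ x‖ ^ 2) + ‖φ x‖ ^ 2 := by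
          intro m
          refine (norm_add_le _ _).trans ?_
          have e1 : ‖φ x * conj (φ x)‖ = ‖φ x‖ ^ 2 := by
            rw [norm_mul, RCLike.norm_conj, sq]
          have e2 : ‖φ x * conj (pd m φ x) + pd m φ x * conj (φ x)‖ ≤
              ‖φ x‖ ^ 2 + ‖pd m φ x‖ ^ 2 := by
            refine (norm_add_le _ _).trans ?_
            rw [norm_mul, norm_mul, RCLike.norm_conj, RCLike.norm_conj]
            nlinarith [sq_nonneg (‖φ x‖ - ‖pd m φ x‖)]
          rw [e1, norm_mul, Complex.norm_real, Real.norm_eq_abs]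
          have := mul_le_mul (hcoord x hx m) e2 (norm_nonneg _) hD0
          linarith
        refine (norm_sum_le _ _).trans ((Finset.sum_le_sum fun m _ => hm m).trans ?_)
        simp only [Fin.sum_univ_two]
        nlinarith [sq_nonneg ‖φ x‖, sq_nonneg ‖pd 0 φ x‖, sq_nonneg ‖pd 1 φ x‖,
          mul_nonneg hD0 (sq_nonneg ‖pd 0 φ x‖), mul_nonneg hD0 (sq_nonneg ‖pd 1 φ x‖)]
  rw [integral_const_mul, integral_add h_int (integrable_finsetSum _ fun m _ => h_intm m),
    integral_finsetSum _ fun m _ => h_intm m] at hkey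
  rw [div_mul_eq_mul_div, le_div_iff₀ hw]
  linarith

/-- The trace inequality. -/
lemma IsStarBall.exists_trace_le (h : E.IsStarBall z r) (k : Fin E.n) :
    ∃ C : ENNReal, C ≠ ⊤ ∧ ∀ φ : Plane → ℂ, ContDiff ℝ ∞ φ →
      eLpNorm (fun s => φ (E.poly.edgePath ℝ k s)) 2 (volume.restrict (Icc (0 : ℝ) 1)) ≤
        C * (eLpNorm φ 2 (volume.restrict E.carrier) +
          ∑ m, eLpNorm (pd m φ) 2 (volume.restrict E.carrier)) := by
  obtain ⟨C, hC, hle⟩ := h.exists_trace_sq_le k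
  refine ⟨ENNReal.ofReal (Real.sqrt C), ENNReal.ofReal_ne_top, fun φ hφ => ?_⟩
  have m0 := E.memLp_comp_edgePath k hφ.continuous
  have m1 := memLp_of_continuous E.isBounded hφ.continuous
  have m2 := fun m => memLp_of_continuous E.isBounded (continuous_pd hφ m)
  have key := hle φ hφ
  rw [intervalIntegral.integral_of_le zero_le_one, ← integral_Icc_eq_integral_Ioc,
    ← toReal_eLpNorm_sq m0, ← toReal_eLpNorm_sq m1] at key
  simp only [fun m => (toReal_eLpNorm_sq (m2 m)).symm, Fin.sum_univ_two] at key
  have hfin : eLpNorm φ 2 (volume.restrict E.carrier) +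
      ∑ m, eLpNorm (pd m φ) 2 (volume.restrict E.carrier) ≠ ⊤ :=
    ENNReal.add_ne_top.2 ⟨m1.eLpNorm_ne_top, ENNReal.sum_ne_top.2 fun m _ => (m2 m).eLpNorm_ne_top⟩
  rw [← ENNReal.toReal_le_toReal m0.eLpNorm_ne_top (ENNReal.mul_ne_top ENNReal.ofReal_ne_top hfin),
    ENNReal.toReal_mul, ENNReal.toReal_ofReal (Real.sqrt_nonneg _),
    ENNReal.toReal_add m1.eLpNorm_ne_top (ENNReal.sum_ne_top.2 fun m _ => (m2 m).eLpNorm_ne_top),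
    ENNReal.toReal_sum fun m _ => (m2 m).eLpNorm_ne_top, Fin.sum_univ_two]
  set A := (eLpNorm (fun s => φ (E.poly.edgePath ℝ k s)) 2 (volume.restrict (Icc (0 : ℝ) 1))).toReal
  set b := (eLpNorm φ 2 (volume.restrict E.carrier)).toReal with hb
  set b0 := (eLpNorm (pd 0 φ) 2 (volume.restrict E.carrier)).toReal with hb0
  set b1 := (eLpNorm (pd 1 φ) 2 (volume.restrict E.carrier)).toReal with hb1
  have n0 : 0 ≤ b := ENNReal.toReal_nonneg
  have n1 : 0 ≤ b0 := ENNReal.toReal_nonneg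
  have n2 : 0 ≤ b1 := ENNReal.toReal_nonneg
  refine abs_le_of_sq_le_sq' ?_ (by positivity) |>.2
  rw [mul_pow, Real.sq_sqrt hC]
  refine key.trans (mul_le_mul_of_nonneg_left ?_ hC)
  nlinarith [mul_nonneg n0 n1, mul_nonneg n0 n2, mul_nonneg n1 n2]

end Element

/-- The `H¹(U)`-distance of a smooth function from `v`. -/
def distH1 (U : Set Plane) (v φ : Plane → ℂ) : ENNReal :=
  eLpNorm (fun x => φ x - v x) 2 (volume.restrict U) +
    ∑ i, eLpNorm (fun x => pd i φ x - weakPartial U v i x) 2 (volume.restrict U)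

lemma TendstoH1.tendsto_distH1 {U : Set Plane} {v : Plane → ℂ} {φ : ℕ → Plane → ℂ}
    (h : TendstoH1 U φ v) : Tendsto (fun n => distH1 U v (φ n)) atTop (𝓝 0) := by
  have := h.1.add (tendsto_finsetSum (Finset.univ : Finset (Fin 2)) fun i _ => h.2 i)
  simpa [distH1] using this

namespace Element

variable {E : Element} {z : Plane} {r : ℝ}

/-- The trace inequality for `φ - ψ`, followed by the triangle inequality through `v`. It yields
both the Cauchy property on the edge and the uniqueness of the limit. -/
lemma IsStarBall.exists_edge_dist_le (h : E.IsStarBall z r) (k : Fin E.n) {v : Plane → ℂ}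
    (hv : MemH1 E.carrier v) :
    ∃ C : ENNReal, C ≠ ⊤ ∧ ∀ φ ψ : Plane → ℂ, ContDiff ℝ ∞ φ → ContDiff ℝ ∞ ψ →
      eLpNorm (fun s => φ (E.poly.edgePath ℝ k s) - ψ (E.poly.edgePath ℝ k s)) 2
        (volume.restrict (Icc (0 : ℝ) 1)) ≤
          C * (distH1 E.carrier v φ + distH1 E.carrier v ψ) := by
  obtain ⟨C, hC, hle⟩ := h.exists_trace_le k
  refine ⟨C, hC, fun φ ψ hφ hψ => (hle _ (hφ.sub hψ)).trans ?_⟩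
  refine mul_le_mul_right ?_ C
  have key : ∀ a b c : Plane → ℂ, MemLp a 2 (volume.restrict E.carrier) →
      MemLp b 2 (volume.restrict E.carrier) → MemLp c 2 (volume.restrict E.carrier) →
      eLpNorm (fun x => a x - b x) 2 (volume.restrict E.carrier) ≤
        eLpNorm (fun x => a x - c x) 2 (volume.restrict E.carrier) +
        eLpNorm (fun x => b x - c x) 2 (volume.restrict E.carrier) := by
    intro a b c ha hb hc
    have := eLpNorm_sub_le (p := 2) (ha.sub hc).aestronglyMeasurable
      (hb.sub hc).aestronglyMeasurable (by norm_num)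
    rwa [sub_sub_sub_cancel_right] at this
  have hb := E.isBounded
  have k0 := key φ ψ v (memLp_of_continuous hb hφ.continuous)
    (memLp_of_continuous hb hψ.continuous) hv.1
  have k1 := fun m => key (pd m φ) (pd m ψ) (weakPartial E.carrier v m)
    (memLp_of_continuous hb (continuous_pd hφ m)) (memLp_of_continuous hb (continuous_pd hψ m))
    (hv.memLp_weakPartial m)
  have e1 : ∀ m, pd m (fun x => φ x - ψ x) = fun x => pd m φ x - pd m ψ x := fun m =>
    funext fun x => pd_sub hφ hψ m x
  simp only [e1]
  calc _ ≤ _ := add_le_add k0 (Finset.sum_le_sum fun m _ => k1 m)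
    _ = _ := by
      rw [Finset.sum_add_distrib, distH1, distH1]
      abel

/-- Traces exist. -/
lemma IsStarBall.exists_isTrace (h : E.IsStarBall z r) (k : Fin E.n) {v : Plane → ℂ}
    (hv : MemH1 E.carrier v) {φ : ℕ → Plane → ℂ} (hφ : ∀ n, ContDiff ℝ ∞ (φ n))
    (hlim : TendstoH1 E.carrier φ v) : ∃ g, IsTrace E.carrier v (E.poly.edgePath ℝ k) g := by
  obtain ⟨C, hC, hle⟩ := h.exists_edge_dist_le k hv
  have hm := fun n => E.memLp_comp_edgePath k (hφ n).continuous
  have hcauchy : CauchySeq fun n => (hm n).toLp := by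
    rw [EMetric.cauchySeq_iff]
    intro ε hε
    have ht : Tendsto (fun n => C * distH1 E.carrier v (φ n)) atTop (𝓝 0) := by
      simpa using ENNReal.Tendsto.const_mul hlim.tendsto_distH1 (Or.inr hC)
    obtain ⟨N, hN⟩ := eventually_atTop.1 (ht.eventually (gt_mem_nhds (ENNReal.half_pos hε.ne')))
    refine ⟨N, fun m hmN n hnN => ?_⟩
    rw [Lp.edist_toLp_toLp]
    refine (hle _ _ (hφ m) (hφ n)).trans_lt ?_
    rw [mul_add, ← ENNReal.add_halves ε]
    exact ENNReal.add_lt_add (hN m hmN) (hN n hnN)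
  obtain ⟨f, hf⟩ := cauchySeq_tendsto_of_complete hcauchy
  -- The limit is a function of the edge parameter, whereas a trace is a function on the plane; the
  -- injective parametrization transports it.
  have hinj : Function.Injective (E.poly.edgePath ℝ k) :=
    AffineMap.lineMap_injective ℝ (E.vertex_ne k)
  have hg : ∀ s, (f ∘ Function.invFun (E.poly.edgePath ℝ k)) (E.poly.edgePath ℝ k s) = f s :=
    fun s => congrArg f (Function.leftInverse_invFun hinj s)
  refine ⟨f ∘ Function.invFun (E.poly.edgePath ℝ k), hv, ?_, φ, hφ, hlim, ?_⟩
  · simp only [hg]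
    exact Lp.memLp f
  · simp only [hg]
    rw [← Lp.toLp_coeFn f (Lp.memLp f), Lp.tendsto_Lp_iff_tendsto_eLpNorm''] at hf
    exact hf

lemma IsStarBall.isTrace_trace (h : E.IsStarBall z r) (k : Fin E.n) {v : Plane → ℂ}
    (hv : MemH1 E.carrier v) {φ : ℕ → Plane → ℂ} (hφ : ∀ n, ContDiff ℝ ∞ (φ n))
    (hlim : TendstoH1 E.carrier φ v) :
    IsTrace E.carrier v (E.poly.edgePath ℝ k) (trace E.carrier v (E.poly.edgePath ℝ k)) := by
  have hex := h.exists_isTrace k hv hφ hlim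
  rw [trace, dif_pos hex]
  exact hex.choose_spec

/-- The restrictions to an edge of any smooth approximating sequence converge to the trace. -/
lemma IsStarBall.tendsto_trace (h : E.IsStarBall z r) (k : Fin E.n) {v : Plane → ℂ}
    (hv : MemH1 E.carrier v) {φ : ℕ → Plane → ℂ} (hφ : ∀ n, ContDiff ℝ ∞ (φ n))
    (hlim : TendstoH1 E.carrier φ v) :
    Tendsto (fun n => eLpNorm (fun s => φ n (E.poly.edgePath ℝ k s) -
      trace E.carrier v (E.poly.edgePath ℝ k) (E.poly.edgePath ℝ k s)) 2
        (volume.restrict (Icc (0 : ℝ) 1))) atTop (𝓝 0) := by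
  -- The chosen trace comes with its own approximating sequence `ψ`, which is compared with `φ`
  -- through the trace inequality.
  obtain ⟨-, hg, ψ, hψ, hψlim, hψg⟩ := h.isTrace_trace k hv hφ hlim
  obtain ⟨C, hC, hle⟩ := h.exists_edge_dist_le k hv
  have ht : Tendsto (fun n => C * (distH1 E.carrier v (φ n) + distH1 E.carrier v (ψ n)))
      atTop (𝓝 0) := by
    simpa using ENNReal.Tendsto.const_mul (hlim.tendsto_distH1.add hψlim.tendsto_distH1)
      (Or.inr hC)
  have ht2 := ht.add hψg
  rw [add_zero] at ht2
  refine tendsto_of_tendsto_of_tendsto_of_le_of_le tendsto_const_nhds ht2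
    (fun n => zero_le) fun n => ?_
  refine le_trans ?_ (add_le_add_left (hle _ _ (hφ n) (hψ n)) _)
  have := eLpNorm_add_le (p := 2)
    ((E.memLp_comp_edgePath k (hφ n).continuous).sub
      (E.memLp_comp_edgePath k (hψ n).continuous)).aestronglyMeasurable
    ((E.memLp_comp_edgePath k (hψ n).continuous).sub hg).aestronglyMeasurable (by norm_num)
  rwa [sub_add_sub_cancel] at this

lemma edgeInt_const_mul (γ : ℝ →ᵃ[ℝ] Plane) (c : ℂ) (f : Plane → ℂ) :
    edgeInt γ (fun x => c * f x) = c * edgeInt γ f := by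
  rw [edgeInt, edgeInt, intervalIntegral.integral_const_mul]
  ring

lemma edgeInt_cj (γ : ℝ →ᵃ[ℝ] Plane) (f : Plane → ℂ) :
    edgeInt γ (fun x => conj (f x)) = conj (edgeInt γ f) := by
  simp only [edgeInt, intervalIntegral.integral_of_le zero_le_one, integral_conj, map_mul,
    Complex.conj_ofReal]

lemma IsStarBall.tendsto_edgeInt (h : E.IsStarBall z r) (k : Fin E.n) {v : Plane → ℂ}
    (hv : MemH1 E.carrier v) {φ : ℕ → Plane → ℂ} (hφ : ∀ n, ContDiff ℝ ∞ (φ n))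
    (hlim : TendstoH1 E.carrier φ v) :
    Tendsto (fun n => edgeInt (E.poly.edgePath ℝ k) (φ n)) atTop
      (𝓝 (edgeInt (E.poly.edgePath ℝ k) (trace E.carrier v (E.poly.edgePath ℝ k)))) := by
  have hg := (h.isTrace_trace k hv hφ hlim).2.1
  have := tendsto_integral_mul_of_tendsto_eLpNorm
    (fun n => E.memLp_comp_edgePath k (hφ n).continuous) hg (memLp_const 1)
    (h.tendsto_trace k hv hφ hlim)
  simp only [mul_one, integral_Icc_eq_integral_Ioc,
    ← intervalIntegral.integral_of_le zero_le_one] at this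
  exact this.const_mul _

end Element

/-! ### Sesquilinear forms and the space `H¹₀` -/

section Forms

variable {U : Set Plane} {κ : Plane → ℝ} {ϑ : Plane → Plane} {w w' v v' : Plane → ℂ}

lemma memLp_top_mul {α : Type*} [MeasurableSpace α] {μ : Measure α} {f g : α → ℂ}
    (hf : MemLp f ⊤ μ) (hg : MemLp g 2 μ) : MemLp (fun x => f x * g x) 2 μ :=
  hg.mul hf

lemma integrable_mul_of_memLp {α : Type*} [MeasurableSpace α] {μ : Measure α} {f g : α → ℂ}
    (hf : MemLp f 2 μ) (hg : MemLp g 2 μ) : Integrable (fun x => f x * g x) μ :=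
  hf.integrable_mul hg

lemma integrable_aForm (hκ : MemLp (fun x => (κ x : ℂ)) ⊤ (volume.restrict U))
    (hw : MemH1 U w) (hv : MemH1 U v) :
    IntegrableOn (fun x => (κ x : ℂ) * ∑ i, weakPartial U w i x * conj (weakPartial U v i x)) U := by
  simp only [Finset.mul_sum, ← mul_assoc]
  exact integrable_finsetSum _ fun i _ => (memLp_top_mul hκ (hw.memLp_weakPartial i)).integrable_mul
    (memLp_conj (hv.memLp_weakPartial i))

lemma memLp_convection (hϑ : ∀ i, MemLp (fun x => (ϑ x i : ℂ)) ⊤ (volume.restrict U))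
    (hw : MemH1 U w) :
    MemLp (fun x => ∑ i, (ϑ x i : ℂ) * weakPartial U w i x) 2 (volume.restrict U) :=
  memLp_finsetSum _ fun i _ => memLp_top_mul (hϑ i) (hw.memLp_weakPartial i)

lemma aForm_sub_left (hU : IsOpen U) (hκ : MemLp (fun x => (κ x : ℂ)) ⊤ (volume.restrict U))
    (hw : MemH1 U w) (hw' : MemH1 U w') (hv : MemH1 U v) :
    aForm κ U (w - w') v = aForm κ U w v - aForm κ U w' v := by
  rw [aForm, aForm, aForm, ← integral_sub (integrable_aForm hκ hw hv) (integrable_aForm hκ hw' hv)]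
  refine integral_congr_ae ?_
  filter_upwards [hw.weakPartial_sub_ae_eq hU hw' 0, hw.weakPartial_sub_ae_eq hU hw' 1]
    with x h0 h1
  simp only [Fin.sum_univ_two, h0, h1, Pi.sub_apply]
  ring

lemma aForm_sub_right (hU : IsOpen U) (hκ : MemLp (fun x => (κ x : ℂ)) ⊤ (volume.restrict U))
    (hw : MemH1 U w) (hv : MemH1 U v) (hv' : MemH1 U v') :
    aForm κ U w (v - v') = aForm κ U w v - aForm κ U w v' := by
  rw [aForm, aForm, aForm, ← integral_sub (integrable_aForm hκ hw hv) (integrable_aForm hκ hw hv')]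
  refine integral_congr_ae ?_
  filter_upwards [hv.weakPartial_sub_ae_eq hU hv' 0, hv.weakPartial_sub_ae_eq hU hv' 1]
    with x h0 h1
  simp only [Fin.sum_univ_two, h0, h1, Pi.sub_apply, map_sub]
  ring

lemma bForm_sub_left (hU : IsOpen U) (hϑ : ∀ i, MemLp (fun x => (ϑ x i : ℂ)) ⊤ (volume.restrict U))
    (hw : MemH1 U w) (hw' : MemH1 U w') (hv : MemLp v 2 (volume.restrict U)) :
    bForm ϑ U (w - w') v = bForm ϑ U w v - bForm ϑ U w' v := by
  rw [bForm, bForm, bForm, ← integral_sub (integrable_mul_of_memLp (memLp_convection hϑ hw) (memLp_conj hv))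
    (integrable_mul_of_memLp (memLp_convection hϑ hw') (memLp_conj hv))]
  refine integral_congr_ae ?_
  filter_upwards [hw.weakPartial_sub_ae_eq hU hw' 0, hw.weakPartial_sub_ae_eq hU hw' 1]
    with x h0 h1
  simp only [Fin.sum_univ_two, h0, h1, Pi.sub_apply]
  ring

lemma bForm_sub_right (hϑ : ∀ i, MemLp (fun x => (ϑ x i : ℂ)) ⊤ (volume.restrict U))
    (hw : MemH1 U w) (hv : MemLp v 2 (volume.restrict U)) (hv' : MemLp v' 2 (volume.restrict U)) :
    bForm ϑ U w (v - v') = bForm ϑ U w v - bForm ϑ U w v' := by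
  rw [bForm, bForm, bForm, ← integral_sub (integrable_mul_of_memLp (memLp_convection hϑ hw) (memLp_conj hv))
    (integrable_mul_of_memLp (memLp_convection hϑ hw) (memLp_conj hv'))]
  congr 1
  funext x
  simp only [Pi.sub_apply, map_sub, mul_sub]

lemma cForm_sub_left (hw : MemLp w 2 (volume.restrict U)) (hw' : MemLp w' 2 (volume.restrict U))
    (hv : MemLp v 2 (volume.restrict U)) :
    cForm U (w - w') v = cForm U w v - cForm U w' v := by
  rw [cForm, cForm, cForm, ← integral_sub (integrable_mul_of_memLp hw (memLp_conj hv))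
    (integrable_mul_of_memLp hw' (memLp_conj hv))]
  congr 1
  funext x
  simp only [Pi.sub_apply, sub_mul]

/-- Weak derivatives commute with conjugation and no conjugate falls on κ, so both integrands are
the same product. This turns the dual form into the primal one. -/
lemma aForm_cj_swap (hU : IsOpen U) (hw : MemH1 U w) (hv : MemH1 U v) :
    aForm κ U (cj v) w = aForm κ U (cj w) v := by
  refine integral_congr_ae ?_
  filter_upwards [hw.weakPartial_cj_ae_eq hU 0, hw.weakPartial_cj_ae_eq hU 1,
    hv.weakPartial_cj_ae_eq hU 0, hv.weakPartial_cj_ae_eq hU 1] with x h0 h1 h2 h3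
  simp only [Fin.sum_univ_two, h0, h1, h2, h3, cj]
  ring

lemma cForm_cj_swap : cForm U (cj v) w = cForm U (cj w) v := by
  simp only [cForm, cj, mul_comm]

/-- The derivatives on `W` and on `U` are chosen separately and agree only almost everywhere, which
suffices for the norms. -/
lemma TendstoH1.mono {W : Set Plane} (hW : IsOpen W) (hU : IsOpen U) (hWU : W ⊆ U)
    (hv : MemH1 U v) {φ : ℕ → Plane → ℂ} (h : TendstoH1 U φ v) : TendstoH1 W φ v := by
  have hle : volume.restrict W ≤ volume.restrict U := Measure.restrict_mono hWU le_rfl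
  refine ⟨tendsto_of_tendsto_of_tendsto_of_le_of_le tendsto_const_nhds h.1 (fun n => zero_le)
    fun n => eLpNorm_mono_measure _ hle, fun i => ?_⟩
  refine tendsto_of_tendsto_of_tendsto_of_le_of_le tendsto_const_nhds (h.2 i) (fun n => zero_le)
    fun n => le_trans (le_of_eq ?_) (eLpNorm_mono_measure _ hle)
  exact eLpNorm_congr_ae ((hv.weakPartial_mono_ae_eq hW hU hWU i).mono fun x hx => by
    simp only [hx])

lemma cj_mem_H10 (hU : IsOpen U) (hv : v ∈ H10 U) : cj v ∈ H10 U := by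
  obtain ⟨hm, φ, hφ, hlim⟩ := hv
  refine ⟨hm.cj, fun n => cj (φ n), fun n => ⟨contDiff_cj (hφ n).1, ?_, ?_⟩, ?_, fun i => ?_⟩
  · exact (hφ n).2.1.comp_left (map_zero _)
  · have : Function.support (cj (φ n)) = Function.support (φ n) := by
      ext x; simp [cj]
    rw [tsupport, this]
    exact (hφ n).2.2
  · refine hlim.1.congr fun n => eLpNorm_congr_norm_ae (Eventually.of_forall fun x => ?_)
    simp only [cj]
    rw [← map_sub, RCLike.norm_conj]
  · refine (hlim.2 i).congr fun n => eLpNorm_congr_norm_ae ?_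
    filter_upwards [hm.weakPartial_cj_ae_eq hU i] with x hx
    rw [pd_cj (hφ n).1, hx, cj, ← map_sub, RCLike.norm_conj]

/-! ### Integration by parts for a divergence-free field -/

lemma integrable_mul_of_tsupport_subset {f h : Plane → ℂ} (hf : ContinuousOn f U)
    (hh : Continuous h) (hc : HasCompactSupport h) (hs : tsupport h ⊆ U) :
    Integrable fun x => f x * h x := by
  rw [← integrableOn_iff_integrable_of_support_subset (s := tsupport h)]
  · exact ((hf.mono hs).mul hh.continuousOn).integrableOn_compact hc
  · exact (Function.support_mul_subset_right _ _).trans (subset_tsupport h)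

/-- Integration by parts moves the derivatives onto ϑ and leaves minus the integral of (div ϑ) h.
Nothing is known of ϑ outside `U`, but there `h` vanishes. -/
lemma integral_divFree_eq_zero (hU : IsOpen U) (hϑ : ContDiffOn ℝ 1 ϑ U)
    (hdiv : ∀ x ∈ U, ∑ i, fderiv ℝ ϑ x (unitVec i) i = 0) {h : Plane → ℂ} (hh : ContDiff ℝ ∞ h)
    (hc : HasCompactSupport h) (hs : tsupport h ⊆ U) :
    ∑ i, ∫ x, (ϑ x i : ℂ) * pd i h x = 0 := by
  have hd : ∀ x ∈ U, DifferentiableAt ℝ ϑ x := fun x hx =>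
    (hϑ.differentiableOn one_ne_zero).differentiableAt (hU.mem_nhds hx)
  let P : Fin 2 → Plane →L[ℝ] ℂ := fun i =>
    Complex.ofRealCLM.comp (EuclideanSpace.proj (𝕜 := ℝ) i : Plane →L[ℝ] ℝ)
  have hfd : ∀ i, ∀ x ∈ U, HasFDerivAt (fun y => (ϑ y i : ℂ)) ((P i).comp (fderiv ℝ ϑ x)) x :=
    fun i x hx => (P i).hasFDerivAt.comp x (hd x hx).hasFDerivAt
  have hcf : ContinuousOn (fderiv ℝ ϑ) U := hϑ.continuousOn_fderiv_of_isOpen hU le_rfl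
  have hcc : ∀ i, ContinuousOn (fun x => ((fderiv ℝ ϑ x (unitVec i) i : ℝ) : ℂ)) U := fun i =>
    (P i).continuous.comp_continuousOn (hcf.clm_apply continuousOn_const)
  have hcϑ : ∀ i, ContinuousOn (fun x => (ϑ x i : ℂ)) U := fun i =>
    (P i).continuous.comp_continuousOn hϑ.continuousOn
  have hcoe : ∀ i x, fderiv ℝ (fun y => (ϑ y i : ℂ)) x (unitVec i) * h x =
      ((fderiv ℝ ϑ x (unitVec i) i : ℝ) : ℂ) * h x := by
    intro i x
    by_cases hx : x ∈ U
    · rw [(hfd i x hx).fderiv]; rfl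
    · rw [image_eq_zero_of_notMem_tsupport (fun hm => hx (hs hm)), mul_zero, mul_zero]
  have hI := fun i => integrable_mul_of_tsupport_subset (hcc i) hh.continuous hc hs
  have hpd : ∀ i, tsupport (pd i h) ⊆ tsupport h := fun i => by
    refine closure_minimal (fun x hx => ?_) (isClosed_tsupport _)
    by_contra hn
    have : fderiv ℝ h x = 0 :=
      image_eq_zero_of_notMem_tsupport (fun hm => hn (tsupport_fderiv_subset ℝ hm))
    exact hx (by rw [pd, this]; rfl)
  have key : ∀ i, ∫ x, (ϑ x i : ℂ) * pd i h x =
      - ∫ x, ((fderiv ℝ ϑ x (unitVec i) i : ℝ) : ℂ) * h x := by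
    intro i
    have := integral_mul_fderiv_eq_neg_fderiv_mul_of_integrable (μ := (volume : Measure Plane))
      (f := fun x => (ϑ x i : ℂ)) (g := h) (v := unitVec i)
      (by simp only [hcoe]; exact hI i)
      (integrable_mul_of_tsupport_subset (hcϑ i) (continuous_pd hh i)
        (hc.fderiv_apply ℝ _) ((hpd i).trans hs))
      (integrable_mul_of_tsupport_subset (hcϑ i) hh.continuous hc hs)
      (fun x hx => (hfd i x (hs hx)).differentiableAt) (fun x _ => hh.differentiable (by simp) x)
    simp only [hcoe] at this
    exact this
  simp only [key]
  rw [Finset.sum_neg_distrib, ← integral_finsetSum _ fun i _ => hI i, neg_eq_zero]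
  refine integral_eq_zero_of_ae (Eventually.of_forall fun x => ?_)
  simp only [← Finset.sum_mul, Pi.zero_apply]
  by_cases hx : x ∈ U
  · rw [← Complex.ofReal_sum, hdiv x hx, Complex.ofReal_zero, zero_mul]
  · rw [image_eq_zero_of_notMem_tsupport (fun hm => hx (hs hm)), mul_zero]

/-- The product rule applied to `φ * ψ`, whose support lies in `U` as soon as that of `φ` does. -/
lemma sum_integral_test_antisymm (hU : IsOpen U) (hUb : Bornology.IsBounded U)
    (hϑ : ContDiffOn ℝ 1 ϑ U) (hϑm : ∀ i, MemLp (fun x => (ϑ x i : ℂ)) ⊤ (volume.restrict U))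
    (hdiv : ∀ x ∈ U, ∑ i, fderiv ℝ ϑ x (unitVec i) i = 0) {φ ψ : Plane → ℂ}
    (hφ : ContDiff ℝ ∞ φ) (hφc : HasCompactSupport φ) (hφs : tsupport φ ⊆ U)
    (hψ : ContDiff ℝ ∞ ψ) :
    ∑ i, ∫ x in U, pd i φ x * ((ϑ x i : ℂ) * ψ x) =
      - ∑ i, ∫ x in U, φ x * ((ϑ x i : ℂ) * pd i ψ x) := by
  have h0 := integral_divFree_eq_zero hU hϑ hdiv (hφ.mul hψ) hφc.mul_right
    ((tsupport_mul_subset_left).trans hφs)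
  have hmul : ∀ i x, pd i (fun x => φ x * ψ x) x = φ x * pd i ψ x + pd i φ x * ψ x :=
    fun i x => pd_mul hφ hψ i x
  have e1 : ∀ i, ∫ x, (ϑ x i : ℂ) * pd i (fun x => φ x * ψ x) x =
      (∫ x in U, pd i φ x * ((ϑ x i : ℂ) * ψ x)) + ∫ x in U, φ x * ((ϑ x i : ℂ) * pd i ψ x) := by
    intro i
    rw [← integral_add, ← setIntegral_eq_integral_of_forall_compl_eq_zero (s := U)]
    · congr 1
      funext x
      rw [hmul]
      ring
    · intro x hx
      have hx' : x ∉ tsupport φ := fun hm => hx (hφs hm)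
      have h1 : fderiv ℝ φ x = 0 :=
        image_eq_zero_of_notMem_tsupport (fun hm => hx' (tsupport_fderiv_subset ℝ hm))
      rw [hmul, image_eq_zero_of_notMem_tsupport hx', pd, pd, h1]
      simp
    · exact (memLp_of_continuous hUb (continuous_pd hφ i)).integrable_mul
        (memLp_top_mul (hϑm i) (memLp_of_continuous hUb hψ.continuous))
    · exact (memLp_of_continuous hUb hφ.continuous).integrable_mul
        (memLp_top_mul (hϑm i) (memLp_of_continuous hUb (continuous_pd hψ i)))
  have h0' : ∑ i, ∫ x, (ϑ x i : ℂ) * pd i (fun x => φ x * ψ x) x = 0 := h0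
  simp only [e1, Finset.sum_add_distrib] at h0'
  exact eq_neg_of_add_eq_zero_left h0'

/-- The convection form of a divergence-free field is antisymmetric on `H¹₀`. -/
lemma sum_integral_antisymm (hU : IsOpen U) (hUb : Bornology.IsBounded U)
    (hϑ : ContDiffOn ℝ 1 ϑ U) (hϑm : ∀ i, MemLp (fun x => (ϑ x i : ℂ)) ⊤ (volume.restrict U))
    (hdiv : ∀ x ∈ U, ∑ i, fderiv ℝ ϑ x (unitVec i) i = 0) (hv : v ∈ H10 U) (hw : w ∈ H10 U) :
    ∑ i, ∫ x in U, w x * ((ϑ x i : ℂ) * weakPartial U v i x) =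
      - ∑ i, ∫ x in U, weakPartial U w i x * ((ϑ x i : ℂ) * v x) := by
  obtain ⟨hvm, φ, hφ, hφv⟩ := hv
  obtain ⟨hwm, ψ, hψ, hψw⟩ := hw
  -- The limit in `φ` is taken first with `ψ m` fixed, then the limit in `m`.
  have step : ∀ m, ∑ i, ∫ x in U, ψ m x * ((ϑ x i : ℂ) * weakPartial U v i x) =
      - ∑ i, ∫ x in U, pd i (ψ m) x * ((ϑ x i : ℂ) * v x) := by
    intro m
    have l1 := tendsto_finsetSum Finset.univ fun i (_ : i ∈ Finset.univ) =>
      tendsto_integral_mul_of_tendsto_eLpNorm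
      (fun n => memLp_of_continuous hUb (continuous_pd (hφ n).1 i)) (hvm.memLp_weakPartial i)
      (memLp_top_mul (hϑm i) (memLp_of_continuous hUb (hψ m).1.continuous)) (hφv.2 i)
    have l2 := (tendsto_finsetSum Finset.univ fun i (_ : i ∈ Finset.univ) =>
      tendsto_integral_mul_of_tendsto_eLpNorm
      (fun n => memLp_of_continuous hUb (hφ n).1.continuous) hvm.1
      (memLp_top_mul (hϑm i) (memLp_of_continuous hUb (continuous_pd (hψ m).1 i))) hφv.1).neg
    have l3 := l2.congr fun n => (sum_integral_test_antisymm hU hUb hϑ hϑm hdiv (hφ n).1 (hφ n).2.1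
      (hφ n).2.2 (hψ m).1).symm
    have e := tendsto_nhds_unique l1 l3
    have c1 : ∀ i x, ψ m x * ((ϑ x i : ℂ) * weakPartial U v i x) =
      weakPartial U v i x * ((ϑ x i : ℂ) * ψ m x) := fun i x => by ring
    have c2 : ∀ i x, pd i (ψ m) x * ((ϑ x i : ℂ) * v x) =
      v x * ((ϑ x i : ℂ) * pd i (ψ m) x) := fun i x => by ring
    simp only [c1, c2]
    exact e
  have l1 := tendsto_finsetSum Finset.univ fun i (_ : i ∈ Finset.univ) =>
    tendsto_integral_mul_of_tendsto_eLpNorm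
    (fun n => memLp_of_continuous hUb (hψ n).1.continuous) hwm.1
    (memLp_top_mul (hϑm i) (hvm.memLp_weakPartial i)) hψw.1
  have l2 := (tendsto_finsetSum Finset.univ fun i (_ : i ∈ Finset.univ) =>
    tendsto_integral_mul_of_tendsto_eLpNorm
    (fun n => memLp_of_continuous hUb (continuous_pd (hψ n).1 i)) (hwm.memLp_weakPartial i)
    (memLp_top_mul (hϑm i) hvm.1) (hψw.2 i)).neg
  exact tendsto_nhds_unique l1 (l2.congr fun n => (step n).symm)

/-- Antisymmetry on the pair of conjugates moves the derivative from v̄ to w̄, and the resulting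
sign is absorbed into the field `-ϑ`. -/
lemma bForm_cj_swap (hU : IsOpen U) (hUb : Bornology.IsBounded U)
    (hϑ : ContDiffOn ℝ 1 ϑ U) (hϑm : ∀ i, MemLp (fun x => (ϑ x i : ℂ)) ⊤ (volume.restrict U))
    (hdiv : ∀ x ∈ U, ∑ i, fderiv ℝ ϑ x (unitVec i) i = 0) (hv : v ∈ H10 U) (hw : w ∈ H10 U) :
    bForm ϑ U (cj v) w = bForm (-ϑ) U (cj w) v := by
  have hcv := cj_mem_H10 hU hv
  have hcw := cj_mem_H10 hU hw
  have key := sum_integral_antisymm hU hUb hϑ hϑm hdiv hcv hcw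
  have e1 : bForm ϑ U (cj v) w =
      ∑ i, ∫ x in U, cj w x * ((ϑ x i : ℂ) * weakPartial U (cj v) i x) := by
    rw [bForm, ← integral_finsetSum _ fun i _ => integrable_mul_of_memLp hcw.1.1
      (memLp_top_mul (hϑm i) (hcv.1.memLp_weakPartial i))]
    congr 1
    funext x
    rw [← Finset.mul_sum, mul_comm, cj]
  have e2 : bForm (-ϑ) U (cj w) v =
      - ∑ i, ∫ x in U, weakPartial U (cj w) i x * ((ϑ x i : ℂ) * cj v x) := by
    rw [bForm, ← integral_finsetSum _ fun i _ => integrable_mul_of_memLp (hcw.1.memLp_weakPartial i)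
      (memLp_top_mul (hϑm i) hcv.1.1), ← integral_neg]
    congr 1
    funext x
    simp only [cj, Fin.sum_univ_two, Pi.neg_apply, PiLp.neg_apply, Complex.ofReal_neg]
    ring
  rw [e1, key, e2]

end Forms

/-! ### Meshes -/

/-- Needed because two elements may traverse their common edge in opposite directions. The endpoints
are the extreme points of a segment, hence determined up to order. -/
lemma eq_or_eq_swap_of_affineSegment_eq {a b c d : Plane} (hab : a ≠ b)
    (h : affineSegment ℝ a b = affineSegment ℝ c d) : (a = c ∧ b = d) ∨ (a = d ∧ b = c) := by
  obtain ⟨s, hs, rfl⟩ : a ∈ affineSegment ℝ c d := h ▸ left_mem_affineSegment ℝ a b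
  obtain ⟨t, ht, rfl⟩ : b ∈ affineSegment ℝ c d := h ▸ right_mem_affineSegment ℝ _ b
  obtain ⟨s', hs', hc⟩ := h.symm ▸ left_mem_affineSegment ℝ c d
  obtain ⟨t', ht', hd⟩ := h.symm ▸ right_mem_affineSegment ℝ c d
  have hcd : c ≠ d := by
    rintro rfl
    simp at hab
  have hinj := AffineMap.lineMap_injective ℝ hcd
  have e1 : (1 - s') * s + s' * t = 0 := by
    rw [← AffineMap.apply_lineMap, AffineMap.lineMap_apply_ring] at hc
    exact hinj (hc.trans (AffineMap.lineMap_apply_zero c d).symm)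
  have e2 : (1 - t') * s + t' * t = 1 := by
    rw [← AffineMap.apply_lineMap, AffineMap.lineMap_apply_ring] at hd
    exact hinj (hd.trans (AffineMap.lineMap_apply_one c d).symm)
  -- The parameter `0` is a convex combination of `s` and `t` in `[0, 1]`, so both nonnegative terms
  -- vanish.
  have h1 : (1 - s') * s = 0 := by
    nlinarith [mul_nonneg (sub_nonneg.2 hs'.2) hs.1, mul_nonneg hs'.1 ht.1]
  have h2 : s' * t = 0 := by linarith
  rcases mul_eq_zero.1 h1 with h3 | h3
  · have ht0 : t = 0 := by
      rcases mul_eq_zero.1 h2 with h4 | h4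
      · linarith
      · exact h4
    subst ht0
    have : s = 1 := by nlinarith [hs.2, ht'.1, mul_nonneg ht'.1 hs.1]
    subst this
    right; simp
  · subst h3
    have : t = 1 := by nlinarith [ht.2, ht'.2, mul_nonneg (sub_nonneg.2 ht'.2) ht.1]
    subst this
    left; simp

lemma edgeInt_lineMap (p q : Plane) (f : Plane → ℂ) :
    edgeInt (AffineMap.lineMap p q) f = (dist p q : ℂ) * segInt f p q := by
  rw [edgeInt, segInt, AffineMap.lineMap_apply_zero, AffineMap.lineMap_apply_one]

lemma edgeInt_eq_of_edgeSet_eq {E F : Element} {k : Fin E.n} {l : Fin F.n}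
    (h : E.poly.edgeSet ℝ k = F.poly.edgeSet ℝ l) (f : Plane → ℂ) :
    edgeInt (E.poly.edgePath ℝ k) f = edgeInt (F.poly.edgePath ℝ l) f := by
  rw [Polygon.edgePath, Polygon.edgePath, edgeInt_lineMap, edgeInt_lineMap]
  rcases eq_or_eq_swap_of_affineSegment_eq (E.vertex_ne k) h with ⟨h1, h2⟩ | ⟨h1, h2⟩
  · rw [h1, h2]
  · rw [h1, h2, dist_comm, segInt_symm]

/-- Summation over the two sides of every interior edge. -/
lemma sum_half_jump {P : Type*} [Fintype P] (bdry : P → Prop) (R : P → P → Prop)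
    [DecidablePred bdry] [∀ p q, Decidable (R p q)] (hsymm : ∀ p q, R p q → R q p)
    (hbdry : ∀ p q, R p q → (bdry p ↔ bdry q)) (hR : ∀ p, ¬ bdry p → ∃! q, R p q)
    (F I : P → ℂ) (hI : ∀ p q, R p q → I p = I q) (hI0 : ∀ p, bdry p → I p = 0) :
    ∑ p, (1 / 2 : ℂ) * (if bdry p then 0 else F p + ∑ q, if R p q then F q else 0) * I p =
      ∑ p, F p * I p := by
  have h1 : ∀ p, (1 / 2 : ℂ) * (if bdry p then 0 else F p + ∑ q, if R p q then F q else 0) * I p =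
      (1 / 2) * (F p * I p) + (1 / 2) * ∑ q, if R p q then F q * I q else 0 := by
    intro p
    by_cases hp : bdry p
    · rw [if_pos hp, hI0 p hp, Finset.sum_eq_zero]
      · simp
      · intro q _
        split_ifs with hq
        · rw [hI0 q ((hbdry p q hq).1 hp), mul_zero]
        · rfl
    · rw [if_neg hp, mul_add, add_mul, mul_assoc, mul_assoc, Finset.sum_mul]
      congr 2
      refine Finset.sum_congr rfl fun q _ => ?_
      split_ifs with hq
      · rw [hI p q hq]
      · rw [zero_mul]
  -- After exchanging the sums, each interior `q` is the partner of exactly one `p`. The double sum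
  -- thus reproduces the plain sum, and the two halves add up.
  have h2 : ∑ p, ∑ q, (if R p q then F q * I q else 0) = ∑ q, F q * I q := by
    rw [Finset.sum_comm]
    refine Finset.sum_congr rfl fun q _ => ?_
    by_cases hq : bdry q
    · rw [hI0 q hq]; simp
    · obtain ⟨p, hp, huniq⟩ := hR q hq
      rw [Finset.sum_eq_single p, if_pos (hsymm _ _ hp)]
      · intro p' _ hne
        exact if_neg fun h => hne (huniq p' (hsymm _ _ h))
      · simp
  simp only [h1]
  rw [Finset.sum_add_distrib, ← Finset.mul_sum, ← Finset.mul_sum, h2]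
  ring

lemma Element.volume_frontier (E : Element) : volume (frontier E.carrier) = 0 := by
  rw [E.frontier_eq]
  refine measure_iUnion_null fun k => measure_mono_null ?_ (volume_line_eq_zero (E.poly k)
    (E.poly (finRotate E.n k)))
  rintro _ ⟨s, -, rfl⟩
  exact AffineMap.lineMap_mem_affineSpan_pair _ _ _

namespace Mesh

variable {Ω : Set Plane} {ι : Type} (M : Mesh Ω ι)

/-- A nonempty open set in the plane has positive diameter, so the radius bound ρ h_E is positive.
-/
lemma exists_isStarBall {M : Mesh Ω ι} {ρ : ℝ} (hρ : 0 < ρ) (h : M.StarShaped ρ) (i : ι) :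
    ∃ z r, (M.elt i).IsStarBall z r := by
  obtain ⟨z, r, hr, hst⟩ := h i
  refine ⟨z, r, lt_of_lt_of_le (mul_pos hρ ?_) hr, hst⟩
  obtain ⟨x, hx⟩ := (M.elt i).isConnected.nonempty
  exact Metric.diam_pos (infinite_of_mem_nhds x ((M.elt i).isOpen.mem_nhds hx)).nontrivial
    (M.elt i).isBounded

lemma exists_flux (κE : ι → ℝ) {p : ι → Plane → ℂ} (hp : ∀ i, p i ∈ P1) :
    ∃ F : (j : ι) × Fin (M.elt j).n → ℂ, ∀ i k x, M.flux κE p i k x = F ⟨i, k⟩ := by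
  choose g hg using fun i => exists_pd_of_mem_P1 (hp i)
  refine ⟨fun q => (κE q.1 : ℂ) * ∑ m, g q.1 m * (((M.elt q.1).normal q.2 m : ℝ) : ℂ),
    fun i k x => ?_⟩
  simp only [flux, hg]

/-- The element is open, so the field κ∇p is constant near each of its points; what κ does on edges
plays no role. -/
lemma divergence_eq_zero {κ : Plane → ℝ} {κE : ι → ℝ} (hκ : M.IsPiecewiseConst κ κE)
    {p : Plane → ℂ} (hp : p ∈ P1) (i : ι) {x : Plane} (hx : x ∈ (M.elt i).carrier) :
    divergence (fun y m => (κ y : ℂ) * pd m p y) x = 0 := by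
  obtain ⟨g, hg⟩ := exists_pd_of_mem_P1 hp
  refine Finset.sum_eq_zero fun m _ => ?_
  have : (fun y => (κ y : ℂ) * pd m p y) =ᶠ[𝓝 x] fun _ => (κE i : ℂ) * g m :=
    ((M.elt i).isOpen.mem_nhds hx |> Filter.mem_of_superset <| fun y hy => by
      simp only [mem_ofPred_eq, hg, hκ i y hy])
  rw [pd, this.fderiv_eq]
  simp

variable [Fintype ι]

/-- The closures cover Ω, so the missing points lie on the element boundaries, which are finite
unions of segments. -/
lemma ae_eq_iUnion : Ω =ᵐ[volume] ⋃ i, (M.elt i).carrier := by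
  refine (ae_le_set.2 ?_).antisymm (iUnion_subset M.subset).eventuallyLE
  refine measure_mono_null (t := ⋃ i, frontier (M.elt i).carrier) ?_
    (measure_iUnion_null fun i => (M.elt i).volume_frontier)
  rintro x ⟨hx, hn⟩
  have hc : x ∈ closure Ω := subset_closure hx
  rw [← M.cover] at hc
  obtain ⟨i, hi⟩ := mem_iUnion.1 hc
  refine mem_iUnion.2 ⟨i, hi, fun h_int => hn (mem_iUnion.2 ⟨i, interior_subset h_int⟩)⟩

lemma setIntegral_eq_sum {f : Plane → ℂ} (hf : IntegrableOn f Ω) :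
    ∫ x in Ω, f x = ∑ i, ∫ x in (M.elt i).carrier, f x := by
  rw [setIntegral_congr_set M.ae_eq_iUnion, integral_iUnion_fintype
    (fun i => (M.elt i).isOpen.measurableSet) (fun i j hij => M.pairwise_disjoint i j hij)
    (fun i => hf.mono_set (M.subset i))]

lemma memLp_of_isPiecewiseConst {κ : Plane → ℝ} {κE : ι → ℝ} (h : M.IsPiecewiseConst κ κE) :
    MemLp (fun x => (κ x : ℂ)) ⊤ (volume.restrict Ω) := by
  rw [Measure.restrict_congr_set M.ae_eq_iUnion]
  have hm := fun i => (M.elt i).isOpen.measurableSet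
  refine memLp_top_of_bound (C := ∑ i, |κE i|) (aestronglyMeasurable_iUnion_iff.2 fun i => ?_) ?_
  · refine (aestronglyMeasurable_const (b := (κE i : ℂ))).congr ?_
    exact (ae_restrict_iff' (hm i)).2 (Eventually.of_forall fun x hx => by simp only [h i x hx])
  · refine (ae_restrict_iff' (MeasurableSet.iUnion hm)).2 (Eventually.of_forall fun x hx => ?_)
    obtain ⟨i, hi⟩ := mem_iUnion.1 hx
    rw [h i x hi, Complex.norm_real, Real.norm_eq_abs]
    exact Finset.single_le_sum (f := fun i => |κE i|) (fun _ _ => abs_nonneg _) (Finset.mem_univ i)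

open Classical in
/-- The fluxes of a piecewise affine function against a test function sum up to its jumps. -/
lemma sum_jump_test (hΩ : IsOpen Ω) (κE : ι → ℝ) (p : ι → Plane → ℂ)
    {φ : Plane → ℂ} (hs : tsupport φ ⊆ Ω) (x : Plane) :
    ∑ i, ∑ k, (1 / 2 : ℂ) * M.jump κE p i k x *
        conj (edgeInt ((M.elt i).poly.edgePath ℝ k) φ) =
      ∑ i, ∑ k, M.flux κE p i k x * conj (edgeInt ((M.elt i).poly.edgePath ℝ k) φ) := by
  -- The index set is that of pairs (element, edge), and two pairs are related when different
  -- elements share the edge. Conformity supplies the unique partner.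
  have key := sum_half_jump (P := (j : ι) × Fin (M.elt j).n)
    (fun q => (M.elt q.1).poly.edgeSet ℝ q.2 ⊆ frontier Ω)
    (fun q q' => q'.1 ≠ q.1 ∧
      (M.elt q'.1).poly.edgeSet ℝ q'.2 = (M.elt q.1).poly.edgeSet ℝ q.2)
    (fun q q' h => ⟨h.1.symm, h.2.symm⟩) (fun q q' h => by rw [h.2])
    (fun q hq => M.conforming q.1 q.2 hq) (fun q => M.flux κE p q.1 q.2 x)
    (fun q => conj (edgeInt ((M.elt q.1).poly.edgePath ℝ q.2) φ))
    (fun q q' h => by rw [edgeInt_eq_of_edgeSet_eq h.2]) ?_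
  · rw [Fintype.sum_sigma, Fintype.sum_sigma] at key
    rw [← key]
    refine Finset.sum_congr rfl fun i _ => Finset.sum_congr rfl fun k _ => ?_
    congr 2
    rw [jump]
    split_ifs
    · rfl
    · rw [Fintype.sum_sigma]
  · intro q hq
    -- On an edge in ∂Ω the test function vanishes, since its support lies in the open set Ω.
    have h0 : ∀ s ∈ uIcc (0 : ℝ) 1, φ ((M.elt q.1).poly.edgePath ℝ q.2 s) = 0 := by
      intro s hs'
      rw [uIcc_of_le zero_le_one] at hs'
      refine image_eq_zero_of_notMem_tsupport fun hm => ?_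
      have : (M.elt q.1).poly.edgePath ℝ q.2 s ∈ Ω ∩ frontier Ω := ⟨hs hm, hq ⟨s, hs', rfl⟩⟩
      rw [hΩ.inter_frontier_eq] at this
      exact this
    rw [edgeInt, intervalIntegral.integral_congr (g := fun _ => 0) h0]
    simp

lemma jump_eq (κE : ι → ℝ) {p : ι → Plane → ℂ} (hp : ∀ i, p i ∈ P1) (i : ι)
    (k : Fin (M.elt i).n) (x y : Plane) : M.jump κE p i k x = M.jump κE p i k y := by
  obtain ⟨F, hF⟩ := M.exists_flux κE hp
  simp only [jump, hF]

/-- Elementwise Green's formula for a piecewise affine function and `v ∈ H¹₀(Ω)`. -/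
lemma sum_aForm_eq_sum_jump (hΩ : IsOpen Ω) {ρ : ℝ} (hρ : 0 < ρ) (hM : M.StarShaped ρ)
    {κ : Plane → ℝ} {κE : ι → ℝ} (hκ : M.IsPiecewiseConst κ κE) {p : ι → Plane → ℂ}
    (hp : ∀ i, p i ∈ P1) {v : Plane → ℂ} (hv : v ∈ H10 Ω) :
    ∑ i, aForm κ (M.elt i).carrier (p i) v =
      ∑ i, ∑ k, edgeInt ((M.elt i).poly.edgePath ℝ k) (fun x =>
        (1 / 2 : ℂ) * M.jump κE p i k x
          * conj (trace (M.elt i).carrier v ((M.elt i).poly.edgePath ℝ k) x)) := by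
  obtain ⟨hvm, φ, hφ, hlim⟩ := hv
  have hvE := fun i => hvm.mono hΩ.measurableSet (M.subset i)
  have hlimE := fun i => hlim.mono (M.elt i).isOpen hΩ (M.subset i) hvm
  choose z r hst using exists_isStarBall hρ hM
  choose g hg using fun i => exists_pd_of_mem_P1 (hp i)
  have hjump : ∀ i k, edgeInt ((M.elt i).poly.edgePath ℝ k) (fun x =>
        (1 / 2 : ℂ) * M.jump κE p i k x
          * conj (trace (M.elt i).carrier v ((M.elt i).poly.edgePath ℝ k) x)) =
      (1 / 2 : ℂ) * M.jump κE p i k 0 * conj (edgeInt ((M.elt i).poly.edgePath ℝ k)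
        (trace (M.elt i).carrier v ((M.elt i).poly.edgePath ℝ k))) := by
    intro i k
    simp only [fun x => M.jump_eq κE hp i k x 0]
    rw [Element.edgeInt_const_mul, Element.edgeInt_cj]
  -- With κ∇p constant on the element, the form only sees the integrals of the weak derivatives of
  -- `v`.
  have ha : ∀ i, aForm κ (M.elt i).carrier (p i) v =
      ∑ m, (κE i : ℂ) * g i m * conj (∫ x in (M.elt i).carrier,
        weakPartial (M.elt i).carrier v m x) := by
    intro i
    have hfin : IsFiniteMeasure (volume.restrict (M.elt i).carrier) :=
      ⟨by simpa using (M.elt i).isBounded.measure_lt_top⟩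
    have h_int : ∀ m, Integrable (fun x => (κE i : ℂ) * g i m *
        conj (weakPartial (M.elt i).carrier v m x)) (volume.restrict (M.elt i).carrier) := fun m =>
      ((memLp_conj ((hvE i).memLp_weakPartial m)).integrable (by norm_num)).const_mul _
    simp only [← integral_conj, ← integral_const_mul]
    rw [← integral_finsetSum _ fun m _ => h_int m, aForm]
    refine integral_congr_ae ?_
    have hw := weakPartial_of_contDiff_ae_eq (M.elt i).isOpen (M.elt i).isBounded
      (contDiff_of_mem_P1 (hp i))
    filter_upwards [hw 0, hw 1, ae_restrict_mem (M.elt i).isOpen.measurableSet] with x h0 h1 hx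
    simp only [Fin.sum_univ_two, h0, h1, hg, hκ i x hx]
    ring
  simp only [ha, hjump]
  have l1 : Tendsto (fun n => ∑ i, ∑ m, (κE i : ℂ) * g i m * conj (∫ x in (M.elt i).carrier,
      pd m (φ n) x)) atTop (𝓝 (∑ i, ∑ m, (κE i : ℂ) * g i m * conj (∫ x in (M.elt i).carrier,
        weakPartial (M.elt i).carrier v m x))) := by
    refine tendsto_finsetSum _ fun i _ => tendsto_finsetSum _ fun m _ => ?_
    refine Tendsto.const_mul _ ((Complex.continuous_conj.tendsto _).comp ?_)
    have hfin : IsFiniteMeasure (volume.restrict (M.elt i).carrier) :=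
      ⟨by simpa using (M.elt i).isBounded.measure_lt_top⟩
    have := tendsto_integral_mul_of_tendsto_eLpNorm
      (fun n => memLp_of_continuous (M.elt i).isBounded (continuous_pd (hφ n).1 m))
      ((hvE i).memLp_weakPartial m) (memLp_const 1) ((hlimE i).2 m)
    simpa only [mul_one] using this
  have l2 : Tendsto (fun n => ∑ i, ∑ k, (1 / 2 : ℂ) * M.jump κE p i k 0 *
      conj (edgeInt ((M.elt i).poly.edgePath ℝ k) (φ n))) atTop
      (𝓝 (∑ i, ∑ k, (1 / 2 : ℂ) * M.jump κE p i k 0 * conj (edgeInt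
        ((M.elt i).poly.edgePath ℝ k)
        (trace (M.elt i).carrier v ((M.elt i).poly.edgePath ℝ k))))) :=
    tendsto_finsetSum _ fun i _ => tendsto_finsetSum _ fun k _ =>
      Tendsto.const_mul _ ((Complex.continuous_conj.tendsto _).comp
        ((hst i).tendsto_edgeInt k (hvE i) (fun n => (hφ n).1) (hlimE i)))
  -- Both sides are limits along the test functions `φ n`, for which the identity is the divergence
  -- theorem on each element combined with the jump rearrangement.
  refine tendsto_nhds_unique l1 (l2.congr fun n => ?_)
  rw [M.sum_jump_test hΩ κE p (hφ n).2.2]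
  refine Finset.sum_congr rfl fun i _ => ?_
  simp only [fun m => (hst i).setIntegral_pd ((hφ n).1.of_le (by norm_cast)) m, map_sum, map_mul,
    Complex.conj_ofReal, flux, hg, Finset.mul_sum, Finset.sum_mul]
  rw [Finset.sum_comm]
  refine Finset.sum_congr rfl fun m _ => Finset.sum_congr rfl fun k _ => ?_
  ring

/-- The residual representation of the form `a + b` on `Ω`. -/
theorem aForm_add_bForm_eq (hΩ : IsOpen Ω) {ρ : ℝ} (hρ : 0 < ρ) (hM : M.StarShaped ρ)
    {κ : Plane → ℝ} {κE : ι → ℝ} (hκ : M.IsPiecewiseConst κ κE) {ϑ : Plane → Plane}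
    (hϑ : ∀ m, MemLp (fun x => (ϑ x m : ℂ)) ⊤ (volume.restrict Ω)) (lamh : ℂ)
    {p q : ι → Plane → ℂ} (hp : ∀ i, p i ∈ P1) (hq : ∀ i, q i ∈ P1) {w v : Plane → ℂ}
    (hw : MemH1 Ω w) (hv : v ∈ H10 Ω) :
    aForm κ Ω w v + bForm ϑ Ω w v =
      lamh * cForm Ω w v
      + ∑ i, (aForm κ (M.elt i).carrier (w - p i) v + bForm ϑ (M.elt i).carrier (w - p i) v
          - lamh * cForm (M.elt i).carrier (w - q i) v)
      - ∑ i, (∫ x in (M.elt i).carrier,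
          (divergence (fun y m => (κ y : ℂ) * pd m (p i) y) x
            - ∑ m, (ϑ x m : ℂ) * pd m (p i) x + lamh * q i x) * conj (v x))
      + ∑ i, ∑ k, edgeInt ((M.elt i).poly.edgePath ℝ k) (fun x =>
          (1 / 2 : ℂ) * M.jump κE p i k x
            * conj (trace (M.elt i).carrier v ((M.elt i).poly.edgePath ℝ k) x)) := by
  rw [← M.sum_aForm_eq_sum_jump hΩ hρ hM hκ hp hv]
  have hκm := M.memLp_of_isPiecewiseConst hκ
  have hle := fun i => Measure.restrict_mono_set (volume : Measure Plane) (M.subset i)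
  have hwE := fun i => hw.mono hΩ.measurableSet (M.subset i)
  have hvE := fun i => hv.1.mono hΩ.measurableSet (M.subset i)
  have hκE := fun i => hκm.mono_measure (hle i)
  have hϑE := fun i m => (hϑ m).mono_measure (hle i)
  have hpE := fun i => memH1_of_contDiff (M.elt i).isBounded (contDiff_of_mem_P1 (hp i))
  have hqE := fun i => memLp_of_continuous (M.elt i).isBounded (contDiff_of_mem_P1 (hq i)).continuous
  have hwp := fun i m => hw.weakPartial_mono_ae_eq (M.elt i).isOpen hΩ (M.subset i) m
  have hvp := fun i m => hv.1.weakPartial_mono_ae_eq (M.elt i).isOpen hΩ (M.subset i) m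
  have ea : aForm κ Ω w v = ∑ i, aForm κ (M.elt i).carrier w v := by
    rw [aForm, M.setIntegral_eq_sum (integrable_aForm hκm hw hv.1)]
    refine Finset.sum_congr rfl fun i _ => integral_congr_ae ?_
    filter_upwards [hwp i 0, hwp i 1, hvp i 0, hvp i 1] with x h0 h1 h2 h3
    simp only [Fin.sum_univ_two, h0, h1, h2, h3]
  have eb : bForm ϑ Ω w v = ∑ i, bForm ϑ (M.elt i).carrier w v := by
    rw [bForm, M.setIntegral_eq_sum (integrable_mul_of_memLp (memLp_convection hϑ hw)
      (memLp_conj hv.1.1))]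
    refine Finset.sum_congr rfl fun i _ => integral_congr_ae ?_
    filter_upwards [hwp i 0, hwp i 1] with x h0 h1
    simp only [Fin.sum_univ_two, h0, h1]
  have ec : cForm Ω w v = ∑ i, cForm (M.elt i).carrier w v :=
    M.setIntegral_eq_sum (integrable_mul_of_memLp hw.1 (memLp_conj hv.1.1))
  -- The divergence term of the residual is zero on each element, which leaves the convection and
  -- mass terms of `p i` and `q i`.
  have er : ∀ i, ∫ x in (M.elt i).carrier,
      (divergence (fun y m => (κ y : ℂ) * pd m (p i) y) x
        - ∑ m, (ϑ x m : ℂ) * pd m (p i) x + lamh * q i x) * conj (v x) =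
      lamh * cForm (M.elt i).carrier (q i) v - bForm ϑ (M.elt i).carrier (p i) v := by
    intro i
    rw [cForm, bForm, ← integral_const_mul, ← integral_sub
      ((integrable_mul_of_memLp (hqE i) (memLp_conj (hvE i).1)).const_mul lamh)
      (integrable_mul_of_memLp (memLp_convection (hϑE i) (hpE i)) (memLp_conj (hvE i).1))]
    refine integral_congr_ae ?_
    have hpp := weakPartial_of_contDiff_ae_eq (M.elt i).isOpen (M.elt i).isBounded
      (contDiff_of_mem_P1 (hp i))
    filter_upwards [hpp 0, hpp 1, ae_restrict_mem (M.elt i).isOpen.measurableSet] with x h0 h1 hx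
    rw [M.divergence_eq_zero hκ (hp i) i hx]
    simp only [Fin.sum_univ_two, h0, h1]
    ring
  rw [ea, eb, ec, Finset.mul_sum, ← Finset.sum_add_distrib, ← Finset.sum_add_distrib,
    ← Finset.sum_sub_distrib, ← Finset.sum_add_distrib]
  refine Finset.sum_congr rfl fun i _ => ?_
  rw [er i, aForm_sub_left (M.elt i).isOpen (hκE i) (hwE i) (hpE i) (hvE i),
    bForm_sub_left (M.elt i).isOpen (hϑE i) (hwE i) (hpE i) (hvE i).1,
    cForm_sub_left (hwE i).1 (hqE i) (hvE i).1]
  ring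

end Mesh

/-! ### Proof of the error equations -/

lemma memLp_top_of_bounded_contDiffOn {Ω : Set Plane} (hΩ : IsOpen Ω) {ϑ : Plane → Plane}
    (hϑ : ContDiffOn ℝ 1 ϑ Ω) (hϑb : ∃ K, ∀ x ∈ Ω, ‖ϑ x‖ ≤ K) (m : Fin 2) :
    MemLp (fun x => (ϑ x m : ℂ)) ⊤ (volume.restrict Ω) := by
  obtain ⟨K, hK⟩ := hϑb
  refine memLp_top_of_bound (C := K) ?_ ?_
  · have hc : ContinuousOn (fun x => (ϑ x m : ℂ)) Ω :=
      (Complex.ofRealCLM.comp (EuclideanSpace.proj (𝕜 := ℝ) m : Plane →L[ℝ] ℝ)).continuous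
        |>.comp_continuousOn hϑ.continuousOn
    exact hc.aestronglyMeasurable hΩ.measurableSet
  · refine (ae_restrict_iff' hΩ.measurableSet).2 (Eventually.of_forall fun x hx => ?_)
    rw [Complex.norm_real]
    exact (PiLp.norm_apply_le (ϑ x) m).trans (hK x hx)

end

end VEM

open VEM in
theorem mainTheorem8 {ι : Type} [Fintype ι] {Ω : Set Plane} (hΩ : IsPolygonalDomain Ω)
    (M : Mesh Ω ι) {ρ C : ℝ} (hρ : 0 < ρ) (hC : 0 < C)
    (hA1 : M.StarShaped ρ) (hA2 : M.VerticesSeparated C)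
    (κ : Plane → ℝ) (κE : ι → ℝ) (hκ : M.IsPiecewiseConst κ κE)
    (hκ₀ : ∃ κ₀ > 0, ∀ x ∈ Ω, κ₀ ≤ κ x)
    (ϑ : Plane → Plane) (hϑ : ContDiffOn ℝ 1 ϑ Ω) (hϑb : ∃ K, ∀ x ∈ Ω, ‖ϑ x‖ ≤ K)
    (hϑdiv : ∀ x ∈ Ω, ∑ i, fderiv ℝ ϑ x (unitVec i) i = 0)
    (S S₀ : ι → (Plane → ℂ) → (Plane → ℂ) → ℂ) {a₀ a₁ c₀ c₁ : ℝ}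
    (ha₀ : 0 < a₀) (ha₁ : 0 < a₁) (hc₀ : 0 < c₀) (hc₁ : 0 < c₁)
    (hS : ∀ i, (M.elt i).IsStabA κ a₀ a₁ (S i)) (hS₀ : ∀ i, (M.elt i).IsStabC c₀ c₁ (S₀ i)) :
    (∀ (lam lamh : ℂ) (u uh : Plane → ℂ),
      IsEigenpair Ω κ ϑ lam u → M.IsDiscreteEigenpair κ ϑ S S₀ lamh uh →
      ∀ v ∈ H10 Ω,
        BForm κ ϑ Ω (u - uh) v =
          lam * cForm Ω u v - lamh * cForm Ω uh v
          - ∑ i, (aForm κ (M.elt i).carrier (uh - (M.elt i).piNabla uh) v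
              + bForm ϑ (M.elt i).carrier (uh - (M.elt i).piNabla uh) v
              - lamh * cForm (M.elt i).carrier (uh - (M.elt i).piZero uh) v)
          + ∑ i, (∫ x in (M.elt i).carrier,
              (divergence (fun y m => (κ y : ℂ) * pd m ((M.elt i).piNabla uh) y) x
                - ∑ m, (ϑ x m : ℂ) * pd m ((M.elt i).piNabla uh) x
                + lamh * (M.elt i).piZero uh x) * conj (v x))
          - ∑ i, ∑ k, edgeInt ((M.elt i).poly.edgePath ℝ k) (fun x =>
              (1 / 2 : ℂ) * M.jump κE (fun j => (M.elt j).piNabla uh) i k x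
                * conj (trace (M.elt i).carrier v ((M.elt i).poly.edgePath ℝ k) x))) ∧
    (∀ (lam lamh : ℂ) (us uhs : Plane → ℂ),
      IsDualEigenpair Ω κ ϑ (conj lam) us →
      M.IsDiscreteDualEigenpair κ ϑ S S₀ (conj lamh) uhs →
      ∀ v ∈ H10 Ω,
        BForm κ ϑ Ω (cj v) (us - uhs) =
          lam * cForm Ω (cj us) v - lamh * cForm Ω (cj uhs) v
          - ∑ i, (aForm κ (M.elt i).carrier (cj uhs - cj ((M.elt i).piNabla uhs)) v
              - bForm ϑ (M.elt i).carrier (cj uhs - cj ((M.elt i).piNabla uhs)) v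
              - lamh * cForm (M.elt i).carrier (cj uhs - cj ((M.elt i).piZero uhs)) v)
          + ∑ i, (∫ x in (M.elt i).carrier,
              (divergence (fun y m => (κ y : ℂ) * pd m (cj ((M.elt i).piNabla uhs)) y) x
                + ∑ m, (ϑ x m : ℂ) * pd m (cj ((M.elt i).piNabla uhs)) x
                + lamh * cj ((M.elt i).piZero uhs) x) * conj (v x))
          - ∑ i, ∑ k, edgeInt ((M.elt i).poly.edgePath ℝ k) (fun x =>
              (1 / 2 : ℂ) * M.jump κE (fun j => cj ((M.elt j).piNabla uhs)) i k x
                * conj (trace (M.elt i).carrier v ((M.elt i).poly.edgePath ℝ k) x))) := by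
  have hϑm := memLp_top_of_bounded_contDiffOn hΩ.isOpen hϑ hϑb
  have hκm := M.memLp_of_isPiecewiseConst hκ
  constructor
  · rintro lam lamh u uh ⟨hu, -, hB⟩ ⟨⟨huh, -⟩, -⟩ v hv
    have key := M.aForm_add_bForm_eq hΩ.isOpen hρ hA1 hκ hϑm lamh
      (fun i => (M.elt i).piNabla_mem_P1 uh) (fun i => (M.elt i).piZero_mem_P1 uh) huh.1 hv
    have hBv := hB v hv
    rw [BForm] at hBv
    rw [BForm, aForm_sub_left hΩ.isOpen hκm hu.1 huh.1 hv.1,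
      bForm_sub_left hΩ.isOpen hϑm hu.1 huh.1 hv.1.1]
    linear_combination hBv - key
  · rintro lam lamh us uhs ⟨hus, -, hB⟩ ⟨⟨huhs, -⟩, -⟩ v hv
    have hcv := cj_mem_H10 hΩ.isOpen hv
    have hϑn : ∀ m, MemLp (fun x => (((-ϑ) x m : ℝ) : ℂ)) ⊤ (volume.restrict Ω) := fun m => by
      simp only [Pi.neg_apply, PiLp.neg_apply, Complex.ofReal_neg]
      exact (hϑm m).neg
    -- The dual discrete function enters through its conjugate, with convection field `-ϑ`; the
    -- conjugated projections are still affine.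
    have key := M.aForm_add_bForm_eq hΩ.isOpen hρ hA1 hκ hϑn lamh
      (fun i => cj_mem_P1 ((M.elt i).piNabla_mem_P1 uhs))
      (fun i => cj_mem_P1 ((M.elt i).piZero_mem_P1 uhs)) huhs.1.cj hv
    have hBv := hB (cj v) hcv
    rw [BForm, Complex.conj_conj, cForm_cj_swap] at hBv
    -- The left side becomes B(v̄, u_h*) for the original field ϑ, to be subtracted from the dual
    -- equation tested with v̄.
    rw [← aForm_cj_swap hΩ.isOpen huhs.1 hv.1,
      ← bForm_cj_swap hΩ.isOpen hΩ.isBounded hϑ hϑm hϑdiv hv huhs] at key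
    -- The signs of `-ϑ` in the element terms are made explicit; this gives the opposite signs of
    -- the convection terms in (ii).
    have hneg : ∀ i f, bForm (-ϑ) (M.elt i).carrier f v = - bForm ϑ (M.elt i).carrier f v := by
      intro i f
      rw [bForm, bForm, ← integral_neg]
      simp only [Pi.neg_apply, PiLp.neg_apply, Complex.ofReal_neg, neg_mul,
        Finset.sum_neg_distrib]
    simp only [hneg, Pi.neg_apply, PiLp.neg_apply, Complex.ofReal_neg, neg_mul,
      Finset.sum_neg_distrib, sub_neg_eq_add, ← sub_eq_add_neg] at key
    rw [BForm, aForm_sub_right hΩ.isOpen hκm hcv.1 hus.1 huhs.1,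
      bForm_sub_right hϑm hcv.1 hus.1.1 huhs.1.1]
    linear_combination hBv - key
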